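/- **Conventions.** Let $n\ge 2$ and $1\le r\le n-1$ be integers, $X_n=\{0,1,\dots,n-1\}$, $\mathfrak C_n=X_n^{\omega}$ the Cantor space of infinite words over $X_n$ with its lexicographic order, and $\mathfrak C_{n,r}=\{\dot a x : \dot a\in\{\dot 0,\dots,\dot{(r-1)}\},\ x\in\mathfrak C_n\}$ the disjoint union of $r$ copies of $\mathfrak C_n$. Let $\simeq$ be the equivalence relation on $\mathfrak C_{n,r}$ that identifies $wi00\ldots$ with $w(i-1)(n-1)(n-1)\ldots$ (where $w$ is a finite word and $i>0$ a letter, or $w$ is empty and $i>\dot 0$ a dotted letter) and $\dot 000\ldots$ with $\dot{(r-1)}(n-1)(n-1)\ldots$; its quotient is the circle $\mathbb R/r\mathbb Z$. A transducer $T$ over $X_n$ has a set of states, a transition function $\pi(x,q)$ with values in the states, and an output function $\lambda(x,q)$ with values in $X_n^*$, for $x\in X_n$ and states $q$; both are extended to words, and every infinite input is required to give an infinite output. Each state $q$ induces a continuous map $h_q:\mathfrak C_n\to\mathfrak C_n$ with image $\operatorname{im}(q)$. Transducers are identified when they agree up to renaming of states. An initial transducer $A_{q_0}$ over $\mathfrak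 C_{n,r}$ reads a dotted letter from $q_0$ and afterwards letters of $X_n$; its states are split as $R\sqcup S$ with $R$ finite and $q_0\in R$. The state $q_0$ is never re-entered, and no state of $R$ lies on a cycle. Transitions between states of $R$ write the empty word, transitions from $R$ to $S$ write a finite word starting with a dotted letter, and from a state of $S$ only states of $S$ are reached, words over $X_n$ are written, and infinite inputs give infinite outputs. Thus $A_{q_0}$ induces a continuous map $h_{q_0}$ from $\mathfrak C_{n,r}$ to itself, and its other states induce maps on $\mathfrak C_n$. It is minimal if all states are accessible from $q_0$, the word written by each transition is the greatest common prefix of the corresponding set of images, and no two distinct states induce the same map. It is synchronizing if for some $k$ the state reached from a non-initial state by reading a word of $X_n^k$ depends only on that word; the states reached in this way form the core $\operatorname{core}(A_{q_0})$, a transducer over $X_n$. Let $\mathcal B_{n,r}$ be the set of finite minimal initial transducers $A_{q_0}$ over $\mathfrak C_{n,r}$ such that $h_{q_0}$ is a homeomorphism and both $A_{q_0}$ and the finite minimal transducer representing $h_{q_0}^{-1}$ are synchronizing. Let $\mathcal{TB}_{n,r}$ be the set of those $A_{q_0}\in\mathcal B_{n,r}$ for which $h_{q_0}$ preserves $\simeq$.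 Put $$\mathcal O_{n,r}=\{\operatorname{core}(A_{q_0}) : A_{q_0}\in\mathcal B_{n,r}\},\quad \mathcal{TO}_{n,r}=\{\operatorname{core}(A_{q_0}) : A_{q_0}\in\mathcal{TB}_{n,r}\},\quad \mathcal O_n=\bigcup_{1\le s\le n-1}\mathcal O_{n,s}.$$ For $g\in\mathcal O_n$, a viable combination of length $j$ for $g$ is a pair of tuples $((\rho_1,\dots,\rho_j),(p_1,\dots,p_j))$ of words $\rho_i\in X_n^*$ and states $p_i$ of $g$ such that the sets $\rho_i\operatorname{im}(p_i)$, $1\le i\le j$, are pairwise disjoint and have union $\mathfrak C_n$. It is lexicographic if, for all $a<b$, every element of $\rho_a\operatorname{im}(p_a)$ is lexicographically smaller than every element of $\rho_b\operatorname{im}(p_b)$. We say that $g$ preserves (respectively reverses) the lexicographic order if $h_q$ does so for every state $q$ of $g$. **Theorem.** For $g\in\mathcal O_n$ the following are equivalent: (a) $g\in\mathcal{TO}_{n,r}$; (b) $g$ preserves or reverses the lexicographic order, and there are $m\ge 1$ and lexicographic viable combinations for $g$ of lengths $j_1,\dots,j_m$ such that $r\equiv\sum_{i=1}^m j_i\equiv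 m \pmod{n-1}$; (c) $g$ preserves or reverses the lexicographic order, and there are $m\ge 1$ and viable combinations for $g$ of lengths $j_1,\dots,j_m$ such that $r\equiv\sum_{i=1}^m j_i\equiv m\pmod{n-1}$; (d) $g\in\mathcal O_{n,r}$, and $g$ preserves or reverses the lexicographic order. -/

import Mathlib

universe u v

namespace HigmanThompson

/-! ### Words and Cantor spaces -/

/-- The Cantor space of infinite words over the alphabet `X_n = {0, …, n-1}`,
with the product topology. -/
abbrev Cantor (n : ℕ) : Type := ℕ → Fin n

/-- The disjoint union of `r` copies of the Cantor space: the point `(a, x)` is the infinite word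
which starts with the dotted letter `a` and continues with `x`. -/
abbrev CantorR (n r : ℕ) : Type := Fin r × Cantor n

/-- The infinite word `w x`. -/
def prepend {n : ℕ} (w : List (Fin n)) (x : Cantor n) : Cantor n :=
  fun i => if h : i < w.length then w[i] else x (i - w.length)

/-- The prefix of length `k` of an infinite word. -/
def initialWord {n : ℕ} (x : Cantor n) (k : ℕ) : List (Fin n) := (List.range k).map x

/-- `w` is a prefix of `x`. -/
def IsPrefixOf {n : ℕ} (w : List (Fin n)) (x : Cantor n) : Prop := ∃ y, x = prepend w y

/-- `w` is the greatest common prefix of the elements of `V`. -/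
def IsGCP {n : ℕ} (w : List (Fin n)) (V : Set (Cantor n)) : Prop :=
  ∀ u : List (Fin n), (∀ x ∈ V, IsPrefixOf u x) ↔ u <+: w

/-- Finite words which start with a dotted letter, together with the empty word `none`. -/
abbrev WordR (n r : ℕ) : Type := Option (Fin r × List (Fin n))

/-- The prefix relation on finite words with a dotted first letter. -/
def WordR.IsPrefix {n r : ℕ} : WordR n r → WordR n r → Prop
  | none, _ => True
  | some _, none => False
  | some (a, u), some (b, w) => a = b ∧ u <+: w

/-- A finite word is a prefix of a point of the `r`-fold Cantor space. -/
def WordR.IsPrefixOf {n r : ℕ} : WordR n r → CantorR n r → Prop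
  | none, _ => True
  | some (a, u), x => x.1 = a ∧ HigmanThompson.IsPrefixOf u x.2

/-- `w` is the greatest common prefix of the elements of `V`. -/
def WordR.IsGCP {n r : ℕ} (w : WordR n r) (V : Set (CantorR n r)) : Prop :=
  ∀ u : WordR n r, (∀ x ∈ V, u.IsPrefixOf x) ↔ u.IsPrefix w

/-- The (strict) lexicographic order on the Cantor space. -/
def LexLT {n : ℕ} (x y : Cantor n) : Prop := toLex x < toLex y

/-- `x = w i 0 0 0 …` and `y = w (i-1) (n-1) (n-1) …` for a finite word `w` and a letter `i > 0`. -/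
def Twin {n : ℕ} (x y : Cantor n) : Prop :=
  ∃ k, (∀ j < k, x j = y j) ∧ (x k : ℕ) = (y k : ℕ) + 1 ∧
    ∀ j > k, (x j : ℕ) = 0 ∧ (y j : ℕ) + 1 = n

/-- `x` and `y` are the two expansions of one point of the circle of length `r`, where `x` ends
in `0 0 0 …` and `y` ends in `(n-1) (n-1) (n-1) …`. In the second alternative the two words differ
already in their dotted letters, which are successive or are the first and the last one. -/
def TwinR {n r : ℕ} (x y : CantorR n r) : Prop :=
  (x.1 = y.1 ∧ Twin x.2 y.2) ∨
  (((x.1 : ℕ) = (y.1 : ℕ) + 1 ∨ ((x.1 : ℕ) = 0 ∧ (y.1 : ℕ) + 1 = r)) ∧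
    ∀ j, (x.2 j : ℕ) = 0 ∧ (y.2 j : ℕ) + 1 = n)

/-- The equivalence relation on the `r`-fold Cantor space whose quotient is the circle
`ℝ / r ℤ`. -/
def CircleEquiv {n r : ℕ} (x y : CantorR n r) : Prop := x = y ∨ TwinR x y ∨ TwinR y x

/-! ### Transducers over the alphabet `X_n` -/

/-- The state reached from `q` after reading a finite word. -/
def runState {n : ℕ} {Q : Type u} (next : Fin n → Q → Q) : List (Fin n) → Q → Q
  | [], q => q
  | i :: w, q => runState next w (next i q)

/-- The word written when a finite word is read from the state `q`. -/
def runOut {n : ℕ} {Q : Type u} (next : Fin n → Q → Q) (out : Fin n → Q → List (Fin n)) :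
    List (Fin n) → Q → List (Fin n)
  | [], _ => []
  | i :: w, q => out i q ++ runOut next out w (next i q)

/-- A (non-initial) transducer over `X_n`, with transition function `next` and output function
`out`, which writes an infinite word whenever it reads an infinite word. -/
structure Transducer (n : ℕ) : Type (u + 1) where
  State : Type u
  next : Fin n → State → State
  out : Fin n → State → List (Fin n)
  productive : ∀ (q : State) (x : Cantor n) (i : ℕ),
    ∃ k, i < (runOut next out (initialWord x k) q).length

namespace Transducer

variable {n : ℕ}

/-- The map `h_q` of the Cantor space induced by the state `q`: the `i`-th letter of the image is
the `i`-th letter of the output, as soon as that output has more than `i` letters. -/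
def map (T : Transducer.{u} n) (q : T.State) (x : Cantor n) : Cantor n := fun i =>
  (runOut T.next T.out (initialWord x (Nat.find (T.productive q x i))) q)[i]'
    (Nat.find_spec (T.productive q x i))

/-- Transducers are equal up to a renaming of the states. -/
structure Iso (T : Transducer.{u} n) (T' : Transducer.{v} n) where
  toEquiv : T.State ≃ T'.State
  next_eq : ∀ i q, toEquiv (T.next i q) = T'.next i (toEquiv q)
  out_eq : ∀ i q, T.out i q = T'.out i (toEquiv q)

/-- All states induce maps that preserve the lexicographic order. -/
def PreservesLex (T : Transducer.{u} n) : Prop :=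
  ∀ (q : T.State) (x y : Cantor n), LexLT x y → LexLT (T.map q x) (T.map q y)

/-- All states induce maps that reverse the lexicographic order. -/
def ReversesLex (T : Transducer.{u} n) : Prop :=
  ∀ (q : T.State) (x y : Cantor n), LexLT x y → LexLT (T.map q y) (T.map q x)

/-- The set `ρ im(p)`. -/
def prefixedImage (T : Transducer.{u} n) (ρ : List (Fin n)) (p : T.State) : Set (Cantor n) :=
  prepend ρ '' Set.range (T.map p)

/-- `((ρ_1, …, ρ_j), (p_1, …, p_j))` is a viable combination: the sets `ρ_i im(p_i)` partition the
Cantor space. -/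
def IsViable (T : Transducer.{u} n) {j : ℕ} (ρ : Fin j → List (Fin n)) (p : Fin j → T.State) :
    Prop :=
  (⋃ i, T.prefixedImage (ρ i) (p i)) = Set.univ ∧
    ∀ i l, i < l → T.prefixedImage (ρ i) (p i) ∩ T.prefixedImage (ρ l) (p l) = ∅

/-- A viable combination is lexicographic if, for `a < b`, every element of `ρ_a im(p_a)` is
lexicographically smaller than every element of `ρ_b im(p_b)`. -/
def IsLexViable (T : Transducer.{u} n) {j : ℕ} (ρ : Fin j → List (Fin n))
    (p : Fin j → T.State) : Prop :=
  T.IsViable ρ p ∧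
    ∀ a b, a < b → ∀ x ∈ T.prefixedImage (ρ a) (p a), ∀ y ∈ T.prefixedImage (ρ b) (p b), LexLT x y

end Transducer

/-! ### Initial transducers over the `r`-fold Cantor space -/

/-- The transition function on the non-initial states. -/
def nextNonInitial {n r : ℕ} {R S : Type u} (next : Fin n → S → S)
    (step : Fin n → R → R ⊕ ((Fin r × List (Fin n)) × S)) (i : Fin n) : R ⊕ S → R ⊕ S
  | .inl q => (step i q).map id Prod.snd
  | .inr s => .inr (next i s)

/-- An initial transducer over the `r`-fold Cantor space. Its states are the initial state `q₀`,
which reads one dotted letter, the states in `R`, from which nothing has been written so far, and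
the states of `inner` (the set `S`), which read and write words over `X_n`. A transition from `q₀`
or from a state in `R` either leads to a state in `R` and writes the empty word, or leads to a state
in `S` and writes a word that starts with a dotted letter. A state that lies on a cycle is
in `S`. -/
structure InitialTransducer (n r : ℕ) : Type (u + 1) where
  inner : Transducer.{u} n
  R : Type u
  finite_R : Finite R
  start : Fin r → R ⊕ ((Fin r × List (Fin n)) × inner.State)
  step : Fin n → R → R ⊕ ((Fin r × List (Fin n)) × inner.State)
  no_cycle : ∀ (w : List (Fin n)) (q : R), w ≠ [] →
    runState (nextNonInitial inner.next step) w (Sum.inl q) ≠ Sum.inl q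

namespace InitialTransducer

variable {n r : ℕ}

/-- The state reached from a non-initial state after reading a finite word over `X_n`. -/
def run (A : InitialTransducer.{u} n r) (w : List (Fin n)) (q : A.R ⊕ A.inner.State) :
    A.R ⊕ A.inner.State :=
  runState (nextNonInitial A.inner.next A.step) w q

/-- The state reached from a state in `R` after reading a finite word over `X_n`, together with
the word written, unless this is empty because the state reached is still in `R`. -/
def runR (A : InitialTransducer.{u} n r) :
    List (Fin n) → A.R → A.R ⊕ ((Fin r × List (Fin n)) × A.inner.State)
  | [], q => .inl q
  | i :: w, q =>
    match A.step i q with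
    | .inl q' => A.runR w q'
    | .inr ((b, u), s) =>
      .inr ((b, u ++ runOut A.inner.next A.inner.out w s), runState A.inner.next w s)

theorem runState_append {Q : Type u} (next : Fin n → Q → Q) (w w' : List (Fin n)) (q : Q) :
    runState next (w ++ w') q = runState next w' (runState next w q) := by
  induction w generalizing q with
  | nil => rfl
  | cons i w ih => exact ih _

theorem run_inr (A : InitialTransducer.{u} n r) (w : List (Fin n)) (s : A.inner.State) :
    A.run w (.inr s) = .inr (runState A.inner.next w s) := by
  induction w generalizing s with
  | nil => rfl
  | cons i w ih => exact ih _

theorem run_inl (A : InitialTransducer.{u} n r) (w : List (Fin n)) (q : A.R) :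
    A.run w (.inl q) = (A.runR w q).map id Prod.snd := by
  induction w generalizing q with
  | nil => rfl
  | cons i w ih =>
    change A.run w ((A.step i q).map id Prod.snd) = _
    rw [runR]
    cases h : A.step i q with
    | inl q' => exact ih q'
    | inr c => exact A.run_inr w c.2

/-- An infinite word, read from a state in `R`, leads out of `R`. -/
theorem exists_leave (A : InitialTransducer.{u} n r) (q : A.R) (x : Cantor n) :
    ∃ k, (A.runR (initialWord x k) q).isRight = true := by
  by_contra hcon
  push Not at hcon
  have h1 : ∀ k, ∃ p : A.R, A.run (initialWord x k) (.inl q) = .inl p := by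
    intro k
    rw [run_inl]
    have h2 := hcon k
    cases h : A.runR (initialWord x k) q with
    | inl p => exact ⟨p, rfl⟩
    | inr c => simp [h] at h2
  choose f hf using h1
  have := A.finite_R
  obtain ⟨a, b, hab, hfab⟩ := Finite.exists_ne_map_eq_of_infinite f
  wlog hlt : a < b generalizing a b
  · exact this b a hab.symm hfab.symm (by omega)
  obtain ⟨d, rfl⟩ := Nat.exists_eq_add_of_lt hlt
  have hw : initialWord x (a + d + 1)
      = initialWord x a ++ (List.range (d + 1)).map (fun i => x (a + i)) := by
    simp [initialWord, add_assoc, List.range_add, Function.comp_def]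
  have h3 := hf (a + d + 1)
  rw [hw, run, runState_append] at h3
  have h4 := hf a
  rw [run] at h4
  rw [h4, ← hfab] at h3
  exact A.no_cycle _ (f a) (by simp) h3

/-- The image of an infinite word `x` read from a state in `S`, preceded by a finite word which has
been written before. -/
def finish (A : InitialTransducer.{u} n r) (c : (Fin r × List (Fin n)) × A.inner.State)
    (x : Cantor n) : CantorR n r :=
  (c.1.1, prepend c.1.2 (A.inner.map c.2 x))

/-- The map `h_q` induced by a state in `R`. -/
def mapR (A : InitialTransducer.{u} n r) (q : A.R) (x : Cantor n) : CantorR n r :=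
  A.finish
    ((A.runR (initialWord x (Nat.find (A.exists_leave q x))) q).getRight
      (Nat.find_spec (A.exists_leave q x)))
    (fun i => x (Nat.find (A.exists_leave q x) + i))

/-- The map induced by the initial state. -/
def map (A : InitialTransducer.{u} n r) (x : CantorR n r) : CantorR n r :=
  match A.start x.1 with
  | .inl q => A.mapR q x.2
  | .inr c => A.finish c x.2

/-- The word written by a transition from the initial state or from a state in `R`. -/
def written {R S : Type u} : R ⊕ ((Fin r × List (Fin n)) × S) → WordR n r
  | .inl _ => none
  | .inr c => some c.1

/-- The transducer is accessible, has no states of incomplete response and no two distinct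
`ω`-equivalent states. -/
structure IsMinimal (A : InitialTransducer.{u} n r) : Prop where
  accessible : ∀ q : A.R ⊕ A.inner.State, ∃ (a : Fin r) (w : List (Fin n)),
    A.run w ((A.start a).map id Prod.snd) = q
  complete_start : ∀ a : Fin r,
    (written (A.start a)).IsGCP (Set.range fun x : Cantor n => A.map (a, x))
  complete_R : ∀ (q : A.R) (i : Fin n),
    (written (A.step i q)).IsGCP (Set.range fun x : Cantor n => A.mapR q (prepend [i] x))
  complete_S : ∀ (s : A.inner.State) (i : Fin n),
    IsGCP (A.inner.out i s) (Set.range fun x : Cantor n => A.inner.map s (prepend [i] x))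
  eq_of_mapR_eq : ∀ q q' : A.R, A.mapR q = A.mapR q' → q = q'
  eq_of_map_eq : ∀ s s' : A.inner.State, A.inner.map s = A.inner.map s' → s = s'

/-- The state reached after reading a word of length `k` over `X_n` depends only on the word. -/
def SynchronizingAt (A : InitialTransducer.{u} n r) (k : ℕ) : Prop :=
  ∀ (w : List (Fin n)), w.length = k → ∀ q q' : A.R ⊕ A.inner.State, A.run w q = A.run w q'

/-- The transducer is synchronizing (at some level). -/
def Synchronizing (A : InitialTransducer.{u} n r) : Prop := ∃ k, A.SynchronizingAt k

/-- `s` is the state forced by some word whose length is a synchronizing level. -/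
def IsCoreState (A : InitialTransducer.{u} n r) (s : A.inner.State) : Prop :=
  ∃ k, A.SynchronizingAt k ∧ ∃ w : List (Fin n), w.length = k ∧ ∀ q, A.run w q = .inr s

theorem IsCoreState.next {A : InitialTransducer.{u} n r} {s : A.inner.State}
    (h : A.IsCoreState s) (i : Fin n) : A.IsCoreState (A.inner.next i s) := by
  obtain ⟨k, hk, w, hw, hs⟩ := h
  refine ⟨k + 1, ?_, w ++ [i], by simp [hw], fun q => ?_⟩
  · intro w' hw' q q'
    cases w' with
    | nil => simp at hw'
    | cons a w' => exact hk w' (by simpa using hw') _ _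
  · have h := hs q
    rw [run] at h
    rw [run, runState_append, h]
    rfl

theorem runOut_core (A : InitialTransducer.{u} n r) (w : List (Fin n))
    (s : {s : A.inner.State // A.IsCoreState s}) :
    runOut (fun i (s : {s : A.inner.State // A.IsCoreState s}) => ⟨A.inner.next i s, s.2.next i⟩)
      (fun i s => A.inner.out i s) w s = runOut A.inner.next A.inner.out w s.1 := by
  induction w generalizing s with
  | nil => rfl
  | cons i w ih => exact congrArg (A.inner.out i s ++ ·) (ih _)

/-- The core of a synchronizing transducer: the sub-transducer on the states that are forced by
words whose length is a synchronizing level. (Such states lie on cycles, hence in `S`.) -/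
def core (A : InitialTransducer.{u} n r) : Transducer.{u} n where
  State := {s : A.inner.State // A.IsCoreState s}
  next i s := ⟨A.inner.next i s, s.2.next i⟩
  out i s := A.inner.out i s
  productive s x i := by
    simpa only [runOut_core] using A.inner.productive s.1 x i

/-- `A` is a finite, minimal, synchronizing transducer. -/
structure IsFiniteMinimalSynchronizing (A : InitialTransducer.{u} n r) : Prop where
  finite : Finite A.inner.State
  minimal : A.IsMinimal
  synchronizing : A.Synchronizing

/-- `A` belongs to `B_{n,r}`: it is the minimal transducer of a homeomorphism of the `r`-fold Cantor
space, it is finite, and it is bi-synchronizing, which means that it and the minimal transducer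
of the inverse homeomorphism are synchronizing. -/
def InB (A : InitialTransducer.{u} n r) : Prop :=
  IsHomeomorph A.map ∧ A.IsFiniteMinimalSynchronizing ∧
    ∃ B : InitialTransducer.{u} n r, B.IsFiniteMinimalSynchronizing ∧
      Function.LeftInverse B.map A.map ∧ Function.RightInverse B.map A.map

/-- `A` belongs to `TB_{n,r}`: it belongs to `B_{n,r}` and its homeomorphism preserves the
equivalence relation that defines the circle. -/
def InTB (A : InitialTransducer.{u} n r) : Prop :=
  A.InB ∧ ∀ x y : CantorR n r, CircleEquiv x y → CircleEquiv (A.map x) (A.map y)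

end InitialTransducer

namespace Transducer

variable {n : ℕ}

/-- `g ∈ O_{n,r}`: `g` is, up to a renaming of the states, the core of an element of `B_{n,r}`. -/
def InOnr (r : ℕ) (g : Transducer.{u} n) : Prop :=
  ∃ A : InitialTransducer.{0} n r, A.InB ∧ Nonempty (Iso A.core g)

/-- `g ∈ TO_{n,r}`: `g` is, up to a renaming of the states, the core of an element
of `TB_{n,r}`. -/
def InTOnr (r : ℕ) (g : Transducer.{u} n) : Prop :=
  ∃ A : InitialTransducer.{0} n r, A.InTB ∧ Nonempty (Iso A.core g)

/-- `g ∈ O_n`, the union of the sets `O_{n,r}` for `1 ≤ r ≤ n - 1`. -/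
def InOn (g : Transducer.{u} n) : Prop := ∃ r, 1 ≤ r ∧ r < n ∧ g.InOnr r

end Transducer

end HigmanThompson

/-!
The proof replaces initial transducers by the homeomorphisms which they induce. `IsCoreOf T f`
says that `T` is reduced (distinct states induce distinct maps, and the images of a state have
no common prefix) and that below every sufficiently long word the local action of `f` is induced
by a state of `T` which depends only on the last `k` letters of that word. The core of a minimal
synchronizing transducer `A` has this property for the map of `A`
(`IsFiniteMinimalSynchronizing.isCoreOf`). Conversely, if a continuous injection `f` satisfies
`IsCoreOf T f`, then the local actions of `f` are the states of a finite minimal synchronizing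
transducer which induces `f` and has core `T` (`IsCoreOf.exists_initialTransducer`). So
`g ∈ O_{n,r}` says that some homeomorphism `f` of the `r`-fold Cantor space has core `g`, and
that its inverse has a core as well.

If `f` preserves the circle, then some state `q` of its core `g` maps twins (the two expansions
of one number) to twins, and thus induces a continuous map of `[0, 1]`. If this map were not
monotone, it would take an irrational value twice, but an irrational number has only one
expansion. Hence `h_q` preserves or reverses the lexicographic order, and so do all states,
since they are reached from `q` (`IsCoreOf.preservesLex_or_reversesLex`).

If `f` has core `g`, the images of the cones of a fixed large depth `L` are `r n^L` sets of the
form `ρ im(p)`, which form one viable combination for each of the `r` dotted letters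
(`IsCoreOf.exists_isViable`); here `r n^L ≡ r` modulo `n - 1`. If moreover the states of `g`
preserve or reverse the order, their images are convex (`IsCoreOf.convex_range`), so that the
parts of a viable combination are linearly ordered and can be sorted
(`Transducer.IsViable.exists_isLexViable`).

Finally, `m` lexicographic viable combinations of total length `J` can be repeated until
`m ≥ r`. As `J ≡ m ≡ r` modulo `n - 1`, the `r`-fold Cantor space can be cut into `J` cones and also
into `m` cones; mapping the former, in increasing or decreasing order, onto the parts of the
combinations placed into the latter gives a monotone bijection `f`
(`HasLexCombinations.inTOnr`). It has core `g`, and its inverse has the same core as the inverse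
of the homeomorphism by which `g` belongs to `O_n` (`exists_homeo_of_assemble`). Since twins are
the pairs of neighbours in the order, together with the pair of the least and the greatest point
(`twinR_iff`), `f` preserves the circle.
-/

namespace HigmanThompson

/-! ### Words and infinite words -/

section Words

variable {n r : ℕ}

theorem prepend_of_lt (w : List (Fin n)) (x : Cantor n) {i : ℕ} (h : i < w.length) :
    prepend w x i = w[i] := by
  simp [prepend, h]

@[simp]
theorem prepend_add (w : List (Fin n)) (x : Cantor n) (i : ℕ) :
    prepend w x (w.length + i) = x i := by
  simp [prepend]

@[simp]
theorem prepend_nil (x : Cantor n) : prepend [] x = x := by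
  funext i
  simp [prepend]

theorem prepend_append (u w : List (Fin n)) (x : Cantor n) :
    prepend (u ++ w) x = prepend u (prepend w x) := by
  funext i
  rcases lt_or_ge i u.length with h | h
  · rw [prepend_of_lt _ _ (by simp; omega), prepend_of_lt _ _ h]
    simp [h]
  · obtain ⟨j, rfl⟩ := Nat.exists_eq_add_of_le h
    rw [prepend_add]
    rcases lt_or_ge j w.length with h' | h'
    · rw [prepend_of_lt _ _ (by simp; omega), prepend_of_lt _ _ h']
      simp
    · obtain ⟨l, rfl⟩ := Nat.exists_eq_add_of_le h'
      rw [prepend_add, ← add_assoc, ← List.length_append, prepend_add]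

theorem prepend_injective (w : List (Fin n)) : Function.Injective (prepend w) := by
  intro x y h
  funext i
  have := congrFun h (w.length + i)
  simpa using this

@[simp]
theorem length_initialWord (x : Cantor n) (k : ℕ) : (initialWord x k).length = k := by
  simp [initialWord]

theorem initialWord_add (x : Cantor n) (k l : ℕ) :
    initialWord x (k + l) = initialWord x k ++ initialWord (fun i => x (k + i)) l := by
  simp [initialWord, List.range_add, Function.comp_def]

theorem prepend_initialWord (x : Cantor n) (k : ℕ) :
    prepend (initialWord x k) (fun i => x (k + i)) = x := by
  funext i
  rcases lt_or_ge i k with h | h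
  · rw [prepend_of_lt _ _ (by simpa using h)]
    simp [initialWord]
  · obtain ⟨j, rfl⟩ := Nat.exists_eq_add_of_le h
    have := prepend_add (initialWord x k) (fun i => x (k + i)) j
    simpa using this

theorem initialWord_prepend (w : List (Fin n)) (x : Cantor n) :
    initialWord (prepend w x) w.length = w := by
  apply List.ext_getElem
  · simp
  · intro i h1 h2
    simp [initialWord, prepend, h2]

theorem initialWord_eq_iff {x y : Cantor n} {k : ℕ} :
    initialWord x k = initialWord y k ↔ ∀ i < k, x i = y i := by
  simp [initialWord]

theorem drop_prepend (w : List (Fin n)) (x : Cantor n) :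
    (fun i => prepend w x (w.length + i)) = x := by
  funext i
  simp

/-- Two factorizations of one infinite word: the shorter prefix is a prefix of the longer one. -/
theorem exists_append_of_prepend_eq {u w : List (Fin n)} {x y : Cantor n}
    (h : prepend u x = prepend w y) (hl : u.length ≤ w.length) :
    ∃ t, w = u ++ t ∧ x = prepend t y := by
  have hw := prepend_initialWord (prepend w y) u.length
  have hu : initialWord (prepend w y) u.length = u := by rw [← h, initialWord_prepend]
  have hpre : u = w.take u.length := by
    apply List.ext_getElem
    · simp [hl]
    · intro i h1 h2
      have := congrFun h i
      rw [prepend_of_lt _ _ h1, prepend_of_lt _ _ (by omega)] at this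
      simp [this]
  refine ⟨w.drop u.length, ?_, ?_⟩
  · conv_lhs => rw [← List.take_append_drop u.length w, ← hpre]
  · apply prepend_injective u
    rw [← prepend_append, h]
    conv_rhs => rw [hpre]
    simp only [List.length_take, min_eq_left hl]
    rw [List.take_append_drop]

theorem isPrefixOf_prepend (w : List (Fin n)) (x : Cantor n) : IsPrefixOf w (prepend w x) :=
  ⟨x, rfl⟩

theorem IsPrefixOf.of_prefix {u w : List (Fin n)} {x : Cantor n} (h : IsPrefixOf w x)
    (hu : u <+: w) : IsPrefixOf u x := by
  obtain ⟨y, rfl⟩ := h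
  obtain ⟨t, rfl⟩ := hu
  exact ⟨prepend t y, prepend_append _ _ _⟩

theorem IsPrefixOf.prefix_of_length_le {u w : List (Fin n)} {x : Cantor n} (hu : IsPrefixOf u x)
    (hw : IsPrefixOf w x) (hl : u.length ≤ w.length) : u <+: w := by
  obtain ⟨y, rfl⟩ := hu
  obtain ⟨z, hz⟩ := hw
  obtain ⟨t, rfl, -⟩ := exists_append_of_prepend_eq hz hl
  exact ⟨t, rfl⟩

theorem isPrefixOf_initialWord (x : Cantor n) (k : ℕ) : IsPrefixOf (initialWord x k) x :=
  ⟨_, (prepend_initialWord x k).symm⟩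

theorem IsPrefixOf.initialWord_eq {w : List (Fin n)} {x : Cantor n} (h : IsPrefixOf w x) :
    initialWord x w.length = w := by
  obtain ⟨y, rfl⟩ := h
  exact initialWord_prepend w y

theorem continuous_prepend (w : List (Fin n)) : Continuous (prepend w) := by
  apply continuous_pi
  intro i
  by_cases h : i < w.length
  · simpa [prepend, h] using continuous_const
  · simpa [prepend, h] using continuous_apply _

theorem lexLT_prepend {w : List (Fin n)} {x y : Cantor n} :
    LexLT (prepend w x) (prepend w y) ↔ LexLT x y := by
  constructor
  · rintro ⟨i, h1, h2⟩
    simp only [Pi.toLex_apply] at h1 h2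
    rcases lt_or_ge i w.length with h | h
    · simp [prepend_of_lt _ _ h] at h2
    · obtain ⟨j, rfl⟩ := Nat.exists_eq_add_of_le h
      refine ⟨j, fun l hl => ?_, by simpa using h2⟩
      have := h1 (w.length + l) (by simpa using hl)
      simpa using this
  · rintro ⟨i, h1, h2⟩
    simp only [Pi.toLex_apply] at h1 h2
    refine ⟨w.length + i, fun l hl => ?_, by simpa using h2⟩
    simp only [Pi.toLex_apply]
    rcases lt_or_ge l w.length with h | h
    · rw [prepend_of_lt _ _ h, prepend_of_lt _ _ h]
    · obtain ⟨j, rfl⟩ := Nat.exists_eq_add_of_le h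
      rw [prepend_add, prepend_add]
      exact h1 j (by simpa using hl)

theorem lexLT_iff {x y : Cantor n} :
    LexLT x y ↔ ∃ i, (∀ j < i, x j = y j) ∧ x i < y i := Iff.rfl

theorem LexLT.trans {x y z : Cantor n} (h : LexLT x y) (h' : LexLT y z) : LexLT x z :=
  lt_trans (a := toLex x) h h'

theorem LexLT.asymm {x y : Cantor n} (h : LexLT x y) : ¬ LexLT y x :=
  lt_asymm (a := toLex x) h

theorem LexLT.ne {x y : Cantor n} (h : LexLT x y) : x ≠ y := by
  rintro rfl
  exact lt_irrefl (toLex x) h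

theorem lexLT_trichotomy (x y : Cantor n) : LexLT x y ∨ x = y ∨ LexLT y x :=
  lt_trichotomy (toLex x) (toLex y)

/-- The continuity of a map at a point, in terms of prefixes. -/
theorem exists_initialWord_of_continuous {φ : Cantor n → Cantor n} (hφ : Continuous φ)
    (x : Cantor n) (m : ℕ) :
    ∃ k, ∀ y, initialWord y k = initialWord x k → initialWord (φ y) m = initialWord (φ x) m := by
  have hopen : IsOpen {y | ∀ i ∈ Finset.range m, φ y i = φ x i} := by
    have : {y | ∀ i ∈ Finset.range m, φ y i = φ x i}
        = ⋂ i ∈ Finset.range m, {y | φ y i = φ x i} := by ext; simp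
    rw [this]
    refine isOpen_biInter_finset fun i _ => ?_
    exact (isOpen_discrete {φ x i}).preimage ((continuous_apply i).comp hφ)
  obtain ⟨s, t, hs, hst⟩ := isOpen_pi_iff.mp hopen x (by simp)
  refine ⟨s.sup id + 1, fun y hy => ?_⟩
  rw [initialWord_eq_iff] at hy ⊢
  intro i hi
  have : y ∈ {y | ∀ i ∈ Finset.range m, φ y i = φ x i} := by
    apply hst
    intro j hj
    rw [hy j (Nat.lt_succ_of_le (Finset.le_sup (f := id) hj))]
    exact (hs j hj).2
  exact this i (by simpa using hi)

theorem exists_cone_subset {U : Set (Cantor n)} (hU : IsOpen U) {x : Cantor n} (hx : x ∈ U) :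
    ∃ k, ∀ y, initialWord y k = initialWord x k → y ∈ U := by
  obtain ⟨s, t, hs, hst⟩ := isOpen_pi_iff.mp hU x hx
  refine ⟨s.sup id + 1, fun y hy => ?_⟩
  rw [initialWord_eq_iff] at hy
  apply hst
  intro j hj
  rw [hy j (Nat.lt_succ_of_le (Finset.le_sup (f := id) hj))]
  exact (hs j hj).2

theorem isOpen_cone (x : Cantor n) (k : ℕ) :
    IsOpen {y : Cantor n | initialWord y k = initialWord x k} := by
  have : {y : Cantor n | initialWord y k = initialWord x k}
      = ⋂ i ∈ Finset.range k, {y | y i = x i} := by ext; simp [initialWord_eq_iff]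
  rw [this]
  refine isOpen_biInter_finset fun i _ => ?_
  exact (isOpen_discrete ({x i} : Set (Fin n))).preimage
    (continuous_apply i : Continuous fun y : Cantor n => y i)

theorem exists_ne_letter (hn : 2 ≤ n) (i : Fin n) : ∃ j, j ≠ i := by
  have : Nontrivial (Fin n) := Fin.nontrivial_iff_two_le.mpr hn
  exact exists_ne i

end Words

/-! ### Greatest common prefixes -/

section GCP

variable {n r : ℕ}

/-- The point `c x` of the `r`-fold Cantor space, where the finite word `c` starts with a dotted
letter. -/
def join (c : Fin r × List (Fin n)) (x : Cantor n) : CantorR n r := (c.1, prepend c.2 x)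

theorem join_append (b : Fin r) (u w : List (Fin n)) (x : Cantor n) :
    join (b, u ++ w) x = join (b, u) (prepend w x) := by
  simp [join, prepend_append]

theorem join_injective (c : Fin r × List (Fin n)) : Function.Injective (join c) := by
  intro x y h
  exact prepend_injective _ (congrArg Prod.snd h)

theorem continuous_join (c : Fin r × List (Fin n)) : Continuous (join c) :=
  continuous_const.prodMk (continuous_prepend _)

/-- The images of `φ` have no common prefix other than the empty word. -/
def Trim (φ : Cantor n → Cantor n) : Prop := IsGCP [] (Set.range φ)

theorem trim_iff {φ : Cantor n → Cantor n} :
    Trim φ ↔ ∀ u, (∀ x, IsPrefixOf u (φ x)) → u = [] := by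
  simp only [Trim, IsGCP, Set.forall_mem_range, List.prefix_nil]
  refine ⟨fun h u => (h u).mp, fun h u => ⟨h u, ?_⟩⟩
  rintro rfl x
  exact ⟨φ x, by simp⟩

theorem Trim.eq_nil {φ : Cantor n → Cantor n} (h : Trim φ) {u : List (Fin n)}
    (hu : ∀ x, IsPrefixOf u (φ x)) : u = [] := trim_iff.mp h u hu

/-- A common prefix of the words `w φ(x)`, where `φ` is trim, is a prefix of `w`. -/
theorem Trim.prefix_of_forall [NeZero n] {φ : Cantor n → Cantor n} (h : Trim φ)
    {u w : List (Fin n)} (hu : ∀ x, IsPrefixOf u (prepend w (φ x))) : u <+: w := by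
  rcases le_total u.length w.length with hl | hl
  · exact (hu 0).prefix_of_length_le (isPrefixOf_prepend _ _) hl
  · obtain ⟨y, hy⟩ := hu 0
    obtain ⟨t, rfl, -⟩ := exists_append_of_prepend_eq hy hl
    have : t = [] := h.eq_nil fun x => by
      obtain ⟨y, hy⟩ := hu x
      rw [prepend_append] at hy
      exact ⟨y, prepend_injective _ hy⟩
    simp [this]

theorem Trim.isGCP [NeZero n] {φ : Cantor n → Cantor n} (h : Trim φ) (w : List (Fin n)) :
    IsGCP w (Set.range fun x => prepend w (φ x)) := by
  intro u
  simp only [Set.forall_mem_range]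
  exact ⟨h.prefix_of_forall, fun hu x => (isPrefixOf_prepend _ _).of_prefix hu⟩

theorem trim_of_isGCP {φ : Cantor n → Cantor n} {w : List (Fin n)}
    (h : IsGCP w (Set.range fun x => prepend w (φ x))) : Trim φ := by
  rw [trim_iff]
  intro u hu
  have h1 : w ++ u <+: w := (h _).mp <| by
    rintro _ ⟨x, rfl⟩
    obtain ⟨y, hy⟩ := hu x
    exact ⟨y, by rw [prepend_append, ← hy]⟩
  have := h1.length_le
  simp at this
  exact this

/-- The decomposition of a map into a constant prefix and a trim map is unique. -/
theorem prepend_trim_unique [NeZero n] {φ ψ : Cantor n → Cantor n} (hφ : Trim φ) (hψ : Trim ψ)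
    {u w : List (Fin n)} (h : ∀ x, prepend u (φ x) = prepend w (ψ x)) : u = w ∧ φ = ψ := by
  have h1 : u <+: w := hψ.prefix_of_forall fun x => by
    rw [← h]
    exact isPrefixOf_prepend _ _
  have h2 : w <+: u := hφ.prefix_of_forall fun x => by
    rw [h]
    exact isPrefixOf_prepend _ _
  obtain rfl : u = w := h1.eq_of_length (le_antisymm h1.length_le h2.length_le)
  exact ⟨rfl, funext fun x => prepend_injective _ (h x)⟩

theorem join_trim_unique [NeZero n] {φ ψ : Cantor n → Cantor n} (hφ : Trim φ) (hψ : Trim ψ)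
    {c d : Fin r × List (Fin n)} (h : ∀ x, join c (φ x) = join d (ψ x)) : c = d ∧ φ = ψ := by
  obtain ⟨h1, h2⟩ := prepend_trim_unique hφ hψ fun x => congrArg Prod.snd (h x)
  have h3 : c.1 = d.1 := congrArg (fun z : CantorR n r => z.1) (h 0)
  exact ⟨Prod.ext h3 h1, h2⟩

theorem Trim.isGCP_join [NeZero n] {φ : Cantor n → Cantor n} (h : Trim φ)
    (c : Fin r × List (Fin n)) :
    WordR.IsGCP (some c) (Set.range fun x => join c (φ x)) := by
  rintro (_ | ⟨b, u⟩)
  · exact ⟨fun _ => trivial, fun _ _ _ => trivial⟩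
  · simp only [Set.forall_mem_range]
    constructor
    · intro hu
      exact ⟨(hu 0).1.symm, h.prefix_of_forall fun x => (hu x).2⟩
    · rintro ⟨rfl, hu⟩ x
      exact ⟨rfl, (isPrefixOf_prepend _ _).of_prefix hu⟩

theorem isGCP_none {ψ : Cantor n → CantorR n r} (h : ∃ x y, (ψ x).1 ≠ (ψ y).1) :
    WordR.IsGCP none (Set.range ψ) := by
  rintro (_ | ⟨b, u⟩)
  · exact ⟨fun _ => trivial, fun _ _ _ => trivial⟩
  · simp only [Set.forall_mem_range]
    obtain ⟨x, y, hxy⟩ := h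
    exact ⟨fun hu => (hxy ((hu x).1.trans (hu y).1.symm)).elim, fun h => h.elim⟩

/-- An injective map splits into a constant prefix and a trim map. -/
theorem exists_trim (hn : 2 ≤ n) {φ : Cantor n → Cantor n} (hφ : Function.Injective φ) :
    ∃ (w : List (Fin n)) (φ' : Cantor n → Cantor n), Trim φ' ∧ ∀ x, φ x = prepend w (φ' x) := by
  classical
  have : NeZero n := ⟨by omega⟩
  have hex : ∃ k, ∃ x, φ x k ≠ φ 0 k := by
    by_contra hcon
    push Not at hcon
    have h01 : (0 : Cantor n) = fun _ => ⟨1, by omega⟩ := hφ (funext fun k => (hcon k _).symm)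
    simpa [Fin.ext_iff] using congrFun h01 0
  set k := Nat.find hex with hk
  have hlt : ∀ x, initialWord (φ x) k = initialWord (φ 0) k := by
    intro x
    rw [initialWord_eq_iff]
    intro i hi
    have := Nat.find_min hex hi
    push Not at this
    exact this x
  refine ⟨initialWord (φ 0) k, fun x i => φ x (k + i), ?_, fun x => ?_⟩
  · rw [trim_iff]
    intro u hu
    obtain ⟨x, hx⟩ := Nat.find_spec hex
    rw [← hk] at hx
    cases u with
    | nil => rfl
    | cons a u =>
      exfalso
      apply hx
      obtain ⟨y, hy⟩ := hu x
      obtain ⟨z, hz⟩ := hu 0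
      have h1 := congrFun hy 0
      have h2 := congrFun hz 0
      simp only [prepend, add_zero] at h1 h2
      rw [h1, h2]
      simp
  · rw [← hlt x, prepend_initialWord]

end GCP

/-! ### Maps induced by transducers -/

section Runs

variable {n : ℕ} {Q : Type u} (next : Fin n → Q → Q) (out : Fin n → Q → List (Fin n))

theorem runOut_append (w w' : List (Fin n)) (q : Q) :
    runOut next out (w ++ w') q
      = runOut next out w q ++ runOut next out w' (runState next w q) := by
  induction w generalizing q with
  | nil => rfl
  | cons i w ih => simp [runOut, runState, ih]

end Runs

namespace Transducer

variable {n : ℕ} (T : Transducer.{u} n)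

/-- The state reached from `q` after reading `w`. -/
abbrev st (w : List (Fin n)) (q : T.State) : T.State := runState T.next w q

/-- The word written when `w` is read from `q`. -/
abbrev wr (w : List (Fin n)) (q : T.State) : List (Fin n) := runOut T.next T.out w q

theorem wr_initialWord_prefix (q : T.State) (x : Cantor n) {k l : ℕ} (h : k ≤ l) :
    T.wr (initialWord x k) q <+: T.wr (initialWord x l) q := by
  obtain ⟨d, rfl⟩ := Nat.exists_eq_add_of_le h
  rw [initialWord_add, wr, wr, runOut_append]
  exact List.prefix_append _ _

theorem map_apply_of_lt (q : T.State) (x : Cantor n) {i k : ℕ}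
    (h : i < (T.wr (initialWord x k) q).length) :
    T.map q x i = (T.wr (initialWord x k) q)[i] := by
  have h1 : Nat.find (T.productive q x i) ≤ k := Nat.find_min' _ h
  exact (T.wr_initialWord_prefix q x h1).getElem _

theorem wr_isPrefixOf_map (q : T.State) (x : Cantor n) (k : ℕ) :
    IsPrefixOf (T.wr (initialWord x k) q) (T.map q x) := by
  set w := T.wr (initialWord x k) q with hw
  refine ⟨fun i => T.map q x (w.length + i), ?_⟩
  funext i
  rcases lt_or_ge i w.length with h | h
  · rw [prepend_of_lt _ _ h, T.map_apply_of_lt q x h]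
  · obtain ⟨j, rfl⟩ := Nat.exists_eq_add_of_le h
    rw [prepend_add]

/-- The induced map is determined by the words written on finite prefixes. -/
theorem map_eq_of_forall (q : T.State) (x y : Cantor n)
    (h : ∀ k, IsPrefixOf (T.wr (initialWord x k) q) y) : T.map q x = y := by
  funext i
  obtain ⟨k, hk⟩ := T.productive q x i
  rw [T.map_apply_of_lt q x hk]
  obtain ⟨z, hz⟩ := h k
  conv_rhs => rw [hz, prepend_of_lt _ _ hk]

theorem map_prepend (q : T.State) (w : List (Fin n)) (x : Cantor n) :
    T.map q (prepend w x) = prepend (T.wr w q) (T.map (T.st w q) x) := by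
  apply map_eq_of_forall
  intro k
  have h1 : T.wr (initialWord (prepend w x) (w.length + k)) q
      = T.wr w q ++ T.wr (initialWord x k) (T.st w q) := by
    rw [initialWord_add, initialWord_prepend, wr, runOut_append]
    congr 3
    exact drop_prepend w x
  obtain ⟨y, hy⟩ := T.wr_isPrefixOf_map (T.st w q) x k
  have h2 : IsPrefixOf (T.wr (initialWord (prepend w x) (w.length + k)) q)
      (prepend (T.wr w q) (T.map (T.st w q) x)) := by
    rw [h1, hy, ← prepend_append]
    exact isPrefixOf_prepend _ _
  exact h2.of_prefix (T.wr_initialWord_prefix q _ (by omega))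

theorem continuous_map (q : T.State) : Continuous (T.map q) := by
  refine continuous_pi fun i => continuous_discrete_rng.mpr fun b => ?_
  rw [isOpen_iff_mem_nhds]
  intro x hx
  obtain ⟨k, hk⟩ := T.productive q x i
  refine Filter.mem_of_superset ((isOpen_cone x k).mem_nhds rfl) fun y hy => ?_
  have hy' : initialWord y k = initialWord x k := hy
  have h1 := T.map_apply_of_lt q x hk
  have h2 := T.map_apply_of_lt q y (i := i) (k := k) (by rw [hy']; exact hk)
  simp only [hy'] at h2
  change T.map q y i = b
  rw [h2, ← h1]
  exact hx

/-- All the induced maps are trim, and distinct states induce distinct maps. Trimness of all the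
maps amounts to every transition writing the greatest common prefix of the corresponding images. -/
structure Reduced : Prop where
  trim : ∀ q, Trim (T.map q)
  map_injective : Function.Injective T.map

variable {T}

end Transducer

/-! ### Local actions of maps of the `r`-fold Cantor space -/

section Core

variable {n r : ℕ}

/-- The reduced transducer `T` describes all but finitely many local actions of `f`: below a
sufficiently long word, the local action of `f` is induced by a state of `T`, which depends only on
the last `k` letters of the word, and every state of `T` occurs. If `f` is the homeomorphism of a
minimal synchronizing initial transducer, this says that `T` is its core. -/
structure IsCoreOf (T : Transducer.{u} n) (f : CantorR n r → CantorR n r) : Prop where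
  reduced : T.Reduced
  exists_local : ∃ (D k : ℕ) (τ : List (Fin n) → T.State),
    (∀ q, ∃ v, v.length = k ∧ τ v = q) ∧
    ∀ (a : Fin r) (w v : List (Fin n)), D ≤ w.length → v.length = k →
      ∃ c : Fin r × List (Fin n), ∀ x, f (join (a, w ++ v) x) = join c (T.map (τ v) x)

/-- The transducer is itself synchronizing: every state is forced by a word. -/
theorem IsCoreOf.exists_sync [NeZero n] [NeZero r] {T : Transducer.{u} n}
    {f : CantorR n r → CantorR n r} (h : IsCoreOf T f) :
    ∃ (D k : ℕ) (τ : List (Fin n) → T.State),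
    (∀ q, ∃ v, v.length = k ∧ τ v = q) ∧
    (∀ q v, v.length = k → T.st v q = τ v) ∧
    ∀ (a : Fin r) (w v : List (Fin n)), D ≤ w.length → v.length = k →
      ∃ c : Fin r × List (Fin n), ∀ x, f (join (a, w ++ v) x) = join c (T.map (τ v) x) := by
  obtain ⟨D, k, τ, hsurj, hloc⟩ := h.exists_local
  refine ⟨D, k, τ, hsurj, fun q v hv => ?_, hloc⟩
  obtain ⟨v₀, hv₀, rfl⟩ := hsurj q
  obtain ⟨c, hc⟩ := hloc 0 (List.replicate D 0) v₀ (by simp) hv₀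
  obtain ⟨c', hc'⟩ := hloc 0 (List.replicate D 0 ++ v₀) v (by simp) hv
  have key : ∀ x, join (c.1, c.2 ++ T.wr v (τ v₀)) (T.map (T.st v (τ v₀)) x)
      = join c' (T.map (τ v) x) := by
    intro x
    rw [← hc', join_append, ← T.map_prepend, join_append, hc]
  exact h.reduced.map_injective (join_trim_unique (h.reduced.trim _) (h.reduced.trim _) key).2

theorem IsCoreOf.finite {T : Transducer.{u} n}
    {f : CantorR n r → CantorR n r} (h : IsCoreOf T f) : Finite T.State := by
  obtain ⟨D, k, τ, hsurj, -⟩ := h.exists_local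
  have : Finite {v : List (Fin n) // v.length = k} :=
    inferInstanceAs (Finite (List.Vector (Fin n) k))
  refine Finite.of_surjective (fun v : {v : List (Fin n) // v.length = k} => τ v.1) fun q => ?_
  obtain ⟨v, hv, rfl⟩ := hsurj q
  exact ⟨⟨v, hv⟩, rfl⟩

theorem Transducer.Iso.wr_eq {T : Transducer.{u} n} {T' : Transducer.{v} n} (e : T.Iso T')
    (w : List (Fin n)) (q : T.State) : T'.wr w (e.toEquiv q) = T.wr w q := by
  induction w generalizing q with
  | nil => rfl
  | cons i w ih =>
    have := ih (T.next i q)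
    rw [e.next_eq] at this
    simp only [Transducer.wr, runOut] at this ⊢
    rw [this, e.out_eq]

theorem Transducer.Iso.map_eq {T : Transducer.{u} n} {T' : Transducer.{v} n} (e : T.Iso T')
    (q : T.State) : T'.map (e.toEquiv q) = T.map q := by
  funext x
  apply Transducer.map_eq_of_forall
  intro k
  rw [e.wr_eq]
  exact T.wr_isPrefixOf_map q x k

theorem IsCoreOf.of_iso {T : Transducer.{u} n} {T' : Transducer.{v} n}
    {f : CantorR n r → CantorR n r} (h : IsCoreOf T f) (e : T.Iso T') : IsCoreOf T' f where
  reduced := by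
    refine ⟨fun q => ?_, fun q q' hq => ?_⟩
    · obtain ⟨q, rfl⟩ := e.toEquiv.surjective q
      rw [e.map_eq]
      exact h.reduced.trim q
    · obtain ⟨q, rfl⟩ := e.toEquiv.surjective q
      obtain ⟨q', rfl⟩ := e.toEquiv.surjective q'
      rw [e.map_eq, e.map_eq] at hq
      rw [h.reduced.map_injective hq]
  exists_local := by
    obtain ⟨D, k, τ, hsurj, hloc⟩ := h.exists_local
    refine ⟨D, k, fun v => e.toEquiv (τ v), fun q => ?_, fun a w v hw hv => ?_⟩
    · obtain ⟨v, hv, hv'⟩ := hsurj (e.toEquiv.symm q)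
      exact ⟨v, hv, by simp [hv']⟩
    · simpa only [e.map_eq] using hloc a w v hw hv

end Core

/-! ### From initial transducers to local actions -/

namespace InitialTransducer

variable {n r : ℕ} (A : InitialTransducer.{u} n r)

theorem runR_append_inr {w w' : List (Fin n)} {q : A.R} {b : Fin r} {u : List (Fin n)}
    {s : A.inner.State} (h : A.runR w q = .inr ((b, u), s)) :
    A.runR (w ++ w') q = .inr ((b, u ++ A.inner.wr w' s), A.inner.st w' s) := by
  induction w generalizing q with
  | nil => simp [runR] at h
  | cons i w ih =>
    simp only [runR, List.cons_append] at h ⊢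
    cases hs : A.step i q with
    | inl p =>
      simp only [hs] at h ⊢
      exact ih h
    | inr c =>
      obtain ⟨⟨b', u'⟩, s'⟩ := c
      simp only [hs, Sum.inr.injEq, Prod.mk.injEq] at h ⊢
      obtain ⟨⟨rfl, rfl⟩, rfl⟩ := h
      simp [runOut_append, runState_append]

theorem finish_eq_join (c : (Fin r × List (Fin n)) × A.inner.State) (x : Cantor n) :
    A.finish c x = join c.1 (A.inner.map c.2 x) := rfl

theorem finish_prepend (b : Fin r) (u w : List (Fin n)) (s : A.inner.State) (x : Cantor n) :
    A.finish ((b, u), s) (prepend w x)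
      = A.finish ((b, u ++ A.inner.wr w s), A.inner.st w s) x := by
  simp [finish_eq_join, join, prepend_append, A.inner.map_prepend]

theorem mapR_of_runR_eq_inr {w : List (Fin n)} {q : A.R}
    {c : (Fin r × List (Fin n)) × A.inner.State} (h : A.runR w q = .inr c) (x : Cantor n) :
    A.mapR q (prepend w x) = A.finish c x := by
  set y := prepend w x with hy
  have hwy : initialWord y w.length = w := initialWord_prepend w x
  set k := Nat.find (A.exists_leave q y) with hk
  have hspec := Nat.find_spec (A.exists_leave q y)
  rw [← hk] at hspec
  obtain ⟨⟨⟨b, u⟩, s⟩, hc⟩ := Sum.isRight_iff.mp hspec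
  have hm : A.mapR q y = A.finish ((b, u), s) (fun i => y (k + i)) := by
    unfold mapR
    congr 1
    simp only [← hk, hc, Sum.getRight_inr]
  have hle : k ≤ w.length := Nat.find_min' _ (by rw [hwy, h]; rfl)
  obtain ⟨d, hd⟩ := Nat.exists_eq_add_of_le hle
  rw [hd, initialWord_add] at hwy
  rw [hm]
  have hwy2 := congrArg (fun w => A.runR w q) hwy
  simp only [A.runR_append_inr hc, h, Sum.inr.injEq] at hwy2
  rw [← hwy2, ← finish_prepend]
  congr 1
  have h2 : w = initialWord y k ++ initialWord (fun i => y (k + i)) d := hwy.symm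
  apply prepend_injective (initialWord y k)
  rw [prepend_initialWord, ← prepend_append, ← h2]

/-- The state reached from the initial state after reading the finite word `a w`. -/
def stateAt (a : Fin r) (w : List (Fin n)) : A.R ⊕ A.inner.State :=
  A.run w ((A.start a).map id Prod.snd)

theorem run_append (w w' : List (Fin n)) (q : A.R ⊕ A.inner.State) :
    A.run (w ++ w') q = A.run w' (A.run w q) := runState_append _ _ _ _

theorem exists_map_eq_of_stateAt {a : Fin r} {w : List (Fin n)} {s : A.inner.State}
    (h : A.stateAt a w = .inr s) :
    ∃ c : Fin r × List (Fin n), ∀ x, A.map (join (a, w) x) = join c (A.inner.map s x) := by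
  unfold stateAt at h
  cases hs : A.start a with
  | inl q =>
    rw [hs, Sum.map_inl, id, run_inl] at h
    cases hr : A.runR w q with
    | inl q' => simp [hr] at h
    | inr c =>
      simp only [hr, Sum.map_inr, Sum.inr.injEq] at h
      refine ⟨c.1, fun x => ?_⟩
      simp only [map, join, hs]
      rw [A.mapR_of_runR_eq_inr hr, finish_eq_join, h]
      rfl
  | inr c =>
    rw [hs, Sum.map_inr, run_inr, Sum.inr.injEq] at h
    obtain ⟨⟨b, u⟩, s'⟩ := c
    refine ⟨(b, u ++ A.inner.wr w s'), fun x => ?_⟩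
    simp only [map, join, hs]
    rw [finish_prepend, finish_eq_join]
    simp only at h
    rw [Transducer.st, h]
    rfl

variable {A}

theorem SynchronizingAt.mono {k l : ℕ} (h : A.SynchronizingAt k) (hkl : k ≤ l) :
    A.SynchronizingAt l := by
  intro w hw q q'
  have h1 := h (w.drop (l - k)) (by simp; omega) (A.run (w.take (l - k)) q)
    (A.run (w.take (l - k)) q')
  rwa [← run_append, ← run_append, List.take_append_drop] at h1

/-- A forced state lies on a cycle, and hence is not in `R`. -/
theorem SynchronizingAt.exists_forced {k : ℕ} (h : A.SynchronizingAt k) (hk : 1 ≤ k)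
    {v : List (Fin n)} (hv : v.length = k) (q : A.R ⊕ A.inner.State) :
    ∃ s, A.run v q = .inr s := by
  cases hq : A.run v q with
  | inr s => exact ⟨s, rfl⟩
  | inl p =>
    have h1 : A.run v (.inl p) = .inl p := (h v hv _ q).trans hq
    exact (A.no_cycle v p (by rintro rfl; simp at hv; omega) h1).elim

theorem core_map (s : A.core.State) : A.core.map s = A.inner.map s.1 := by
  funext x
  apply Transducer.map_eq_of_forall
  intro k
  have := A.runOut_core (initialWord x k) s
  have h2 : A.core.wr (initialWord x k) s = A.inner.wr (initialWord x k) s.1 := this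
  rw [h2]
  exact A.inner.wr_isPrefixOf_map s.1 x k

/-- The core of a minimal synchronizing transducer describes the local actions of its map. -/
theorem IsFiniteMinimalSynchronizing.isCoreOf [NeZero n] [NeZero r]
    (hA : A.IsFiniteMinimalSynchronizing) : IsCoreOf A.core A.map := by
  obtain ⟨k₀, hk₀⟩ := hA.synchronizing
  set k := k₀ + 1 with hkdef
  have hk : A.SynchronizingAt k := hk₀.mono (by omega)
  have hforce : ∀ v : List (Fin n), v.length = k →
      ∃ s : A.core.State, ∀ q, A.run v q = .inr s.1 := by
    intro v hv
    obtain ⟨s, hs⟩ := hk.exists_forced (by omega) hv ((A.start 0).map id Prod.snd)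
    have hs' : ∀ q, A.run v q = .inr s := fun q => (hk v hv _ _).trans hs
    exact ⟨⟨s, k, hk, v, hv, hs'⟩, hs'⟩
  have : Nonempty A.core.State :=
    ⟨(hforce (List.replicate k 0) (List.length_replicate ..)).choose⟩
  choose! τ hτ using hforce
  have hsurj : ∀ s : A.core.State, ∃ v, v.length = k ∧ τ v = s := by
    rintro ⟨s, l, hl, w, hw, hs⟩
    -- the last `k` letters of `0^k w` also force `s`, whether or not `w` is longer than `k`
    refine ⟨(List.replicate k 0 ++ w).drop l, by simp [hw], ?_⟩
    have hv : ((List.replicate k 0 ++ w).drop l).length = k := by simp [hw]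
    have h1 := hτ _ hv (A.run ((List.replicate k 0 ++ w).take l) (.inr s))
    rw [← run_append, List.take_append_drop, run_append, hs] at h1
    exact Subtype.ext (Sum.inr_injective h1).symm
  refine ⟨⟨fun s => ?_, fun s s' h => ?_⟩, ?_⟩
  · rw [core_map]
    obtain ⟨v, hv, hvs⟩ := hsurj s
    have h1 := hτ v hv (.inr s.1)
    rcases List.eq_nil_or_concat v with rfl | ⟨v', i, rfl⟩
    · simp [hkdef] at hv
    rw [run_inr, List.concat_eq_append, runState_append, ← List.concat_eq_append, hvs,
      Sum.inr.injEq] at h1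
    have h2 := hA.minimal.complete_S (runState A.inner.next v' s.1) i
    apply trim_of_isGCP (w := A.inner.out i (runState A.inner.next v' s.1))
    convert h2 using 3 with x
    rw [A.inner.map_prepend]
    simp only [runState] at h1
    simp [Transducer.wr, Transducer.st, runOut, runState, h1]
  · rw [core_map, core_map] at h
    exact Subtype.ext (hA.minimal.eq_of_map_eq _ _ h)
  · refine ⟨0, k, τ, hsurj, fun a w v _ hv => ?_⟩
    simp only [core_map]
    apply exists_map_eq_of_stateAt
    rw [stateAt, run_append]
    exact hτ v hv _

end InitialTransducer

/-! ### The minimal transducer of a continuous injection -/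

section Construction

variable {n r : ℕ}

/-- `ψ` is the restriction of `f` to a cone `a w X_n^ω`, written as a map of `x ∈ X_n^ω`. -/
def IsRestriction (f : CantorR n r → CantorR n r) (ψ : Cantor n → CantorR n r) : Prop :=
  ∃ (a : Fin r) (w : List (Fin n)), ∀ x, ψ x = f (join (a, w) x)

/-- The restrictions of `f` to cones whose images do not all start with the same dotted letter. -/
def RState (f : CantorR n r → CantorR n r) : Type :=
  {ψ : Cantor n → CantorR n r // IsRestriction f ψ ∧ ∃ x y, (ψ x).1 ≠ (ψ y).1}

/-- The local actions of `f`: the restrictions of `f` to cones with the greatest common prefix of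
the images removed, where this prefix is non-empty. -/
def SState (f : CantorR n r → CantorR n r) : Type :=
  {φ : Cantor n → Cantor n // Trim φ ∧ ∃ c, IsRestriction f fun x => join c (φ x)}

variable {f : CantorR n r → CantorR n r}

theorem IsRestriction.comp_prepend {ψ : Cantor n → CantorR n r} (h : IsRestriction f ψ)
    (w : List (Fin n)) : IsRestriction f fun x => ψ (prepend w x) := by
  obtain ⟨a, u, hu⟩ := h
  exact ⟨a, u ++ w, fun x => (hu _).trans (by rw [join_append])⟩

theorem IsRestriction.injective (hi : Function.Injective f) {ψ : Cantor n → CantorR n r}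
    (h : IsRestriction f ψ) : Function.Injective ψ := by
  obtain ⟨a, u, hu⟩ := h
  intro x y hxy
  rw [hu, hu] at hxy
  exact join_injective _ (hi hxy)

theorem SState.injective (hi : Function.Injective f) (φ : SState f) :
    Function.Injective φ.1 := by
  obtain ⟨c, hc⟩ := φ.2.2
  intro x y hxy
  exact hc.injective hi (congrArg (join c) hxy)

theorem SState.continuous (hc : Continuous f) (φ : SState f) : Continuous φ.1 := by
  obtain ⟨c, a, w, hw⟩ := φ.2.2
  refine continuous_pi fun i => ?_
  have h1 : (fun x => φ.1 x i) = fun x => (f (join (a, w) x)).2 (c.2.length + i) := by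
    funext x
    rw [← hw]
    simp [join]
  rw [h1]
  exact (continuous_apply _).comp (continuous_snd.comp (hc.comp (continuous_join _)))

theorem SState.exists_next (hn : 2 ≤ n) (hi : Function.Injective f) (i : Fin n) (φ : SState f) :
    ∃ p : List (Fin n) × SState f, ∀ x, φ.1 (prepend [i] x) = prepend p.1 (p.2.1 x) := by
  obtain ⟨u, φ', hφ', h⟩ := exists_trim hn
    ((φ.injective hi).comp (prepend_injective [i]))
  obtain ⟨c, hc⟩ := φ.2.2
  refine ⟨(u, ⟨φ', hφ', (c.1, c.2 ++ u), ?_⟩), h⟩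
  have := hc.comp_prepend [i]
  simp only [join_append]
  convert this using 2 with x
  exact congrArg (join c) (h x).symm

theorem exists_classify (hn : 2 ≤ n) (hi : Function.Injective f) (ψ : Cantor n → CantorR n r)
    (hψ : IsRestriction f ψ) :
    ∃ z : RState f ⊕ ((Fin r × List (Fin n)) × SState f),
      (∀ ψ', z = .inl ψ' → ψ'.1 = ψ) ∧ (∀ c, z = .inr c → ∀ x, ψ x = join c.1 (c.2.1 x)) := by
  have : NeZero n := ⟨by omega⟩
  by_cases h : ∃ x y, (ψ x).1 ≠ (ψ y).1
  · exact ⟨.inl ⟨ψ, hψ, h⟩, by rintro _ ⟨⟩; rfl, by rintro _ ⟨⟩⟩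
  · push Not at h
    have h1 : Function.Injective fun x => (ψ x).2 := fun x y hxy =>
      hψ.injective hi (Prod.ext (h x y) hxy)
    obtain ⟨u, φ, hφ, hu⟩ := exists_trim hn h1
    have h2 : ∀ x, ψ x = join ((ψ 0).1, u) (φ x) := fun x => Prod.ext (h x 0) (hu x)
    refine ⟨.inr (((ψ 0).1, u), ⟨φ, hφ, ((ψ 0).1, u), ?_⟩), by rintro _ ⟨⟩, ?_⟩
    · rwa [← funext h2]
    · rintro _ ⟨⟩
      exact h2

variable (hn : 2 ≤ n) (hc : Continuous f) (hi : Function.Injective f)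

/-- The state which describes a restriction of `f`, together with the greatest common prefix of the
images if this prefix is non-empty. -/
noncomputable def classify (ψ : Cantor n → CantorR n r) (hψ : IsRestriction f ψ) :
    RState f ⊕ ((Fin r × List (Fin n)) × SState f) := (exists_classify hn hi ψ hψ).choose

theorem classify_inl {ψ : Cantor n → CantorR n r} {hψ : IsRestriction f ψ} {ψ' : RState f}
    (h : classify hn hi ψ hψ = .inl ψ') : ψ'.1 = ψ :=
  (exists_classify hn hi ψ hψ).choose_spec.1 ψ' h

theorem classify_inr {ψ : Cantor n → CantorR n r} {hψ : IsRestriction f ψ}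
    {c : (Fin r × List (Fin n)) × SState f}
    (h : classify hn hi ψ hψ = .inr c) (x : Cantor n) : ψ x = join c.1 (c.2.1 x) :=
  (exists_classify hn hi ψ hψ).choose_spec.2 c h x

theorem classify_eq_inl {ψ : Cantor n → CantorR n r} (hψ : IsRestriction f ψ)
    (h : ∃ x y, (ψ x).1 ≠ (ψ y).1) : classify hn hi ψ hψ = .inl ⟨ψ, hψ, h⟩ := by
  cases hz : classify hn hi ψ hψ with
  | inl ψ' => exact congrArg Sum.inl (Subtype.ext (classify_inl hn hi hz))
  | inr c =>
    obtain ⟨x, y, hxy⟩ := h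
    rw [classify_inr hn hi hz, classify_inr hn hi hz] at hxy
    exact (hxy rfl).elim

theorem classify_eq_inr [NeZero n] {ψ : Cantor n → CantorR n r} (hψ : IsRestriction f ψ)
    {c : Fin r × List (Fin n)} {φ : SState f} (h : ∀ x, ψ x = join c (φ.1 x)) :
    classify hn hi ψ hψ = .inr (c, φ) := by
  cases hz : classify hn hi ψ hψ with
  | inl ψ' =>
    obtain ⟨x, y, hxy⟩ := ψ'.2.2
    rw [classify_inl hn hi hz, h, h] at hxy
    exact (hxy rfl).elim
  | inr c' =>
    obtain ⟨h1, h2⟩ := join_trim_unique c'.2.2.1 φ.2.1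
      fun x => (classify_inr hn hi hz x).symm.trans (h x)
    exact congrArg Sum.inr (Prod.ext h1 (Subtype.ext h2))

/-- Reading a letter from a local action: the word written and the local action reached. -/
noncomputable def SState.read (i : Fin n) (φ : SState f) : List (Fin n) × SState f :=
  (φ.exists_next hn hi i).choose

theorem SState.read_spec (i : Fin n) (φ : SState f) (x : Cantor n) :
    φ.1 (prepend [i] x) = prepend (φ.read hn hi i).1 ((φ.read hn hi i).2.1 x) :=
  (φ.exists_next hn hi i).choose_spec x

theorem SState.run_spec (w : List (Fin n)) (φ : SState f) (x : Cantor n) :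
    φ.1 (prepend w x) =
      prepend (runOut (fun i φ => (SState.read hn hi i φ).2) (fun i φ => (SState.read hn hi i φ).1)
        w φ) ((runState (fun i φ => (SState.read hn hi i φ).2) w φ).1 x) := by
  induction w generalizing φ with
  | nil => simp [runOut, runState]
  | cons i w ih =>
    have h1 : prepend (i :: w) x = prepend [i] (prepend w x) := by
      rw [← prepend_append]; rfl
    rw [h1, SState.read_spec hn hi, ih]
    simp [runOut, runState, prepend_append]

/-- The transducer whose states are the local actions of `f`. -/
noncomputable def localTransducer : Transducer.{0} n where
  State := SState f
  next i φ := (φ.read hn hi i).2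
  out i φ := (φ.read hn hi i).1
  productive φ x i := by
    have : NeZero n := ⟨by omega⟩
    obtain ⟨k, hk⟩ := exists_initialWord_of_continuous (φ.continuous hc) x (i + 1)
    refine ⟨k, ?_⟩
    -- the common prefix of length `i + 1` is contained in the greatest common prefix
    have h1 : initialWord (φ.1 x) (i + 1) <+: _ :=
      (runState (fun i φ => (SState.read hn hi i φ).2) (initialWord x k) φ).2.1.prefix_of_forall
        fun y => by
          rw [← SState.run_spec hn hi, ← hk (prepend (initialWord x k) y)]
          · exact isPrefixOf_initialWord _ _
          · have := initialWord_prepend (initialWord x k) y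
            rwa [length_initialWord] at this
    have := h1.length_le
    simp only [length_initialWord] at this
    omega

theorem localTransducer_map (φ : SState f) :
    (localTransducer hn hc hi).map φ = φ.1 := by
  funext x
  apply Transducer.map_eq_of_forall
  intro k
  have h := SState.run_spec hn hi (initialWord x k) φ (fun i => x (k + i))
  rw [prepend_initialWord] at h
  exact ⟨_, h⟩

theorem isRestriction_cone (a : Fin r) (w : List (Fin n)) :
    IsRestriction f fun x => f (join (a, w) x) := ⟨a, w, fun _ => rfl⟩

/-- The state of the minimal transducer which describes a restriction of `f`. -/
noncomputable def stateOf (ψ : Cantor n → CantorR n r) (hψ : IsRestriction f ψ) :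
    RState f ⊕ SState f := (classify hn hi ψ hψ).map id Prod.snd

/-- The transition function on the restrictions of `f` without a common dotted letter. -/
noncomputable def RState.step (i : Fin n) (ψ : RState f) :
    RState f ⊕ ((Fin r × List (Fin n)) × SState f) :=
  classify hn hi (fun x => ψ.1 (prepend [i] x)) (ψ.2.1.comp_prepend [i])

theorem next_stateOf (i : Fin n) {ψ : Cantor n → CantorR n r} (hψ : IsRestriction f ψ) :
    nextNonInitial (fun i φ => (SState.read hn hi i φ).2) (RState.step hn hi) i
      (stateOf hn hi ψ hψ) = stateOf hn hi _ (hψ.comp_prepend [i]) := by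
  have : NeZero n := ⟨by omega⟩
  unfold stateOf
  cases hz : classify hn hi ψ hψ with
  | inl ψ' =>
    obtain rfl := classify_inl hn hi hz
    rfl
  | inr c =>
    obtain ⟨⟨b, u⟩, φ⟩ := c
    have h1 : classify hn hi _ (hψ.comp_prepend [i])
        = .inr ((b, u ++ (φ.read hn hi i).1), (φ.read hn hi i).2) := by
      apply classify_eq_inr
      intro x
      rw [classify_inr hn hi hz, join_append, SState.read_spec hn hi]
    rw [h1]
    rfl

theorem run_stateOf (w : List (Fin n)) {ψ : Cantor n → CantorR n r} (hψ : IsRestriction f ψ) :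
    runState (nextNonInitial (fun i φ => (SState.read hn hi i φ).2) (RState.step hn hi)) w
      (stateOf hn hi ψ hψ) = stateOf hn hi _ (hψ.comp_prepend w) := by
  induction w generalizing ψ with
  | nil => simp [runState]
  | cons i w ih =>
    rw [runState, next_stateOf, ih]
    congr
    funext x
    rw [← prepend_append]
    rfl

theorem stateOf_inl (ψ : RState f) : stateOf hn hi ψ.1 ψ.2.1 = .inl ψ := by
  unfold stateOf
  rw [classify_eq_inl hn hi ψ.2.1 ψ.2.2]
  rfl

theorem stateOf_inr [NeZero n] {ψ : Cantor n → CantorR n r} (hψ : IsRestriction f ψ)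
    {c : Fin r × List (Fin n)} {φ : SState f} (h : ∀ x, ψ x = join c (φ.1 x)) :
    stateOf hn hi ψ hψ = .inr φ := by
  unfold stateOf
  rw [classify_eq_inr hn hi hψ h]
  rfl

theorem exists_eq_stateOf (q : RState f ⊕ SState f) :
    ∃ (a : Fin r) (w : List (Fin n)), q = stateOf hn hi _ (isRestriction_cone a w) := by
  have : NeZero n := ⟨by omega⟩
  cases q with
  | inl ψ =>
    obtain ⟨a, w, h⟩ := ψ.2.1
    refine ⟨a, w, ?_⟩
    rw [← stateOf_inl hn hi ψ]
    congr
    exact funext h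
  | inr φ =>
    obtain ⟨c, a, w, h⟩ := φ.2.2
    exact ⟨a, w, (stateOf_inr hn hi _ fun x => (h x).symm).symm⟩

theorem stateOf_append (a : Fin r) (w w' : List (Fin n)) :
    runState (nextNonInitial (fun i φ => (SState.read hn hi i φ).2) (RState.step hn hi)) w'
      (stateOf hn hi _ (isRestriction_cone a w))
      = stateOf hn hi _ (isRestriction_cone (f := f) a (w ++ w')) := by
  rw [run_stateOf]
  congr
  funext x
  rw [join_append]

/-- The minimal initial transducer of `f`, provided that `f` has only finitely many restrictions to
cones whose images do not start with the same dotted letter. -/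
noncomputable def minimalTransducer (hfin : Finite (RState f)) : InitialTransducer.{0} n r where
  inner := localTransducer hn hc hi
  R := RState f
  finite_R := hfin
  start a := classify hn hi _ (isRestriction_cone a [])
  step := RState.step hn hi
  no_cycle w ψ hw h := by
    -- otherwise `ψ (w x) = ψ x` for all `x`, but `x` and `w` can start with different letters
    have h1 := run_stateOf hn hi w ψ.2.1
    rw [stateOf_inl] at h1
    have h2 : stateOf hn hi _ (ψ.2.1.comp_prepend w) = .inl ψ := h1.symm.trans h
    unfold stateOf at h2
    cases hz : classify hn hi _ (ψ.2.1.comp_prepend w) with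
    | inr c => simp [hz] at h2
    | inl ψ' =>
      rw [hz, Sum.map_inl, id, Sum.inl.injEq] at h2
      subst h2
      have h3 := classify_inl hn hi hz
      cases w with
      | nil => exact hw rfl
      | cons i w =>
        obtain ⟨j, hj⟩ := exists_ne_letter hn i
        have h4 := ψ'.2.1.injective hi (congrFun h3 fun _ => j)
        have h5 := congrFun h4 0
        rw [prepend_of_lt _ _ (by simp)] at h5
        exact hj h5

variable (hfin : Finite (RState f))

theorem minimalTransducer_mapR (ψ : RState f) :
    (minimalTransducer hn hc hi hfin).mapR ψ = ψ.1 := by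
  funext x
  obtain ⟨k, hk⟩ := (minimalTransducer hn hc hi hfin).exists_leave ψ x
  obtain ⟨c, hck⟩ := Sum.isRight_iff.mp hk
  have key : ∀ (w : List (Fin n)) (ψ : RState f) (c : (Fin r × List (Fin n)) × SState f),
      (minimalTransducer hn hc hi hfin).runR w ψ = .inr c → ∀ y,
        ψ.1 (prepend w y) = join c.1 (c.2.1 y) := by
    intro w
    induction w with
    | nil =>
      intro ψ c h
      simp [InitialTransducer.runR] at h
    | cons i w ih =>
      intro ψ c h y
      have h1 : prepend (i :: w) y = prepend [i] (prepend w y) := by rw [← prepend_append]; rfl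
      simp only [InitialTransducer.runR] at h
      rw [h1]
      cases hs : (minimalTransducer hn hc hi hfin).step i ψ with
      | inl ψ' =>
        simp only [hs] at h
        have h2 : ψ'.1 = fun x => ψ.1 (prepend [i] x) :=
          classify_inl hn hi (hψ := ψ.2.1.comp_prepend [i]) hs
        have h3 := ih ψ' c h y
        rw [h2] at h3
        exact h3
      | inr d =>
        obtain ⟨⟨b, u⟩, φ⟩ := d
        simp only [hs] at h
        have h2 := classify_inr hn hi (hψ := ψ.2.1.comp_prepend [i]) hs (prepend w y)
        rw [← Sum.inr_injective h]
        refine h2.trans ?_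
        rw [SState.run_spec hn hi w φ y, ← join_append]
        rfl
  have h1 := (minimalTransducer hn hc hi hfin).mapR_of_runR_eq_inr hck (fun i => x (k + i))
  have h2 := key _ _ _ hck (fun i => x (k + i))
  rw [prepend_initialWord] at h1 h2
  rw [h1, h2, InitialTransducer.finish_eq_join]
  congr 1
  exact congrFun (localTransducer_map hn hc hi c.2) _

theorem minimalTransducer_map : (minimalTransducer hn hc hi hfin).map = f := by
  funext ⟨a, x⟩
  have hax : f (a, x) = f (join (a, []) x) := by simp [join]
  unfold InitialTransducer.map
  cases hs : (minimalTransducer hn hc hi hfin).start a with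
  | inl ψ =>
    simp only
    rw [minimalTransducer_mapR hn hc hi hfin ψ, hax]
    exact congrFun (classify_inl hn hi (hψ := isRestriction_cone a []) hs) x
  | inr c =>
    simp only
    rw [InitialTransducer.finish_eq_join, hax]
    have h1 := classify_inr hn hi (hψ := isRestriction_cone a []) hs x
    rw [h1]
    congr 1
    exact congrFun (localTransducer_map hn hc hi c.2) _

theorem classify_isGCP {ψ : Cantor n → CantorR n r} (hψ : IsRestriction f ψ) :
    (InitialTransducer.written (classify hn hi ψ hψ)).IsGCP (Set.range ψ) := by
  have : NeZero n := ⟨by omega⟩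
  cases hz : classify hn hi ψ hψ with
  | inl ψ' =>
    rw [← classify_inl hn hi hz]
    exact isGCP_none ψ'.2.2
  | inr c =>
    rw [funext (classify_inr hn hi hz)]
    exact c.2.2.1.isGCP_join c.1

theorem minimalTransducer_isMinimal : (minimalTransducer hn hc hi hfin).IsMinimal := by
  have : NeZero n := ⟨by omega⟩
  refine ⟨fun q => ?_, fun a => ?_, fun ψ i => ?_, fun φ i => ?_, fun ψ ψ' h => ?_,
    fun φ φ' h => ?_⟩
  · obtain ⟨a, w, rfl⟩ := exists_eq_stateOf hn hi q
    exact ⟨a, w, stateOf_append hn hi a [] w⟩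
  · rw [minimalTransducer_map]
    have h := classify_isGCP hn hi (isRestriction_cone (f := f) a [])
    have h2 : (fun x : Cantor n => f (join (a, []) x)) = fun x => f (a, x) := by
      simp only [join, prepend_nil]
    exact h2 ▸ h
  · rw [minimalTransducer_mapR hn hc hi hfin ψ]
    exact classify_isGCP hn hi (ψ.2.1.comp_prepend [i])
  · change IsGCP (SState.read hn hi i φ).1
      (Set.range fun x => (localTransducer hn hc hi).map φ (prepend [i] x))
    rw [localTransducer_map hn hc hi φ]
    have h := funext (SState.read_spec hn hi i φ)
    rw [h]
    exact (SState.read hn hi i φ).2.2.1.isGCP _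
  · rw [minimalTransducer_mapR hn hc hi hfin ψ, minimalTransducer_mapR hn hc hi hfin ψ'] at h
    exact Subtype.ext h
  · have h' : (localTransducer hn hc hi).map φ = (localTransducer hn hc hi).map φ' := h
    rw [localTransducer_map hn hc hi φ, localTransducer_map hn hc hi φ'] at h'
    exact Subtype.ext h'

end Construction

section Construction

variable {n r : ℕ} {f : CantorR n r → CantorR n r}

theorem finite_words_le (n D : ℕ) : Finite {w : List (Fin n) // w.length ≤ D} :=
  (List.finite_length_le (Fin n) D).to_subtype

/-- The local action below a long word writes a dotted letter, so that all elements of `RState f`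
are restrictions to cones of bounded depth. -/
theorem IsCoreOf.finite_RState {T : Transducer.{u} n} (h : IsCoreOf T f) : Finite (RState f) := by
  obtain ⟨D, k, τ, hsurj, hloc⟩ := h.exists_local
  have := finite_words_le n (D + k)
  choose a w haw using fun ψ : RState f => ψ.2.1
  have hlen : ∀ ψ, (w ψ).length ≤ D + k := by
    intro ψ
    by_contra hlt
    obtain ⟨x, y, hxy⟩ := ψ.2.2
    have hw : w ψ = (w ψ).take ((w ψ).length - k) ++ (w ψ).drop ((w ψ).length - k) :=
      (List.take_append_drop _ _).symm
    obtain ⟨c, hc⟩ := hloc (a ψ) ((w ψ).take ((w ψ).length - k))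
      ((w ψ).drop ((w ψ).length - k)) (by simp; omega) (by simp; omega)
    rw [← hw] at hc
    rw [haw, haw, hc, hc] at hxy
    exact hxy rfl
  refine Finite.of_injective (β := Fin r × {w : List (Fin n) // w.length ≤ D + k})
    (fun ψ => (a ψ, ⟨w ψ, hlen ψ⟩)) fun ψ ψ' hψ => ?_
  simp only [Prod.mk.injEq, Subtype.mk.injEq] at hψ
  refine Subtype.ext (funext fun x => ?_)
  rw [haw, haw, hψ.1, hψ.2]

/-- A local action is induced by a state of `T`, or it is the local action below a short word. -/
theorem IsCoreOf.finite_SState [NeZero n] {T : Transducer.{u} n} (h : IsCoreOf T f) :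
    Finite (SState f) := by
  have hT := h.finite
  obtain ⟨D, k, τ, hsurj, hloc⟩ := h.exists_local
  have := finite_words_le n (D + k)
  choose c a w haw using fun φ : SState f => φ.2.2
  have hlong : ∀ φ : SState f, ¬ (w φ).length ≤ D + k → ∃ q, φ.1 = T.map q := by
    intro φ hlt
    have hw : w φ = (w φ).take ((w φ).length - k) ++ (w φ).drop ((w φ).length - k) :=
      (List.take_append_drop _ _).symm
    obtain ⟨d, hd⟩ := hloc (a φ) ((w φ).take ((w φ).length - k))
      ((w φ).drop ((w φ).length - k)) (by simp; omega) (by simp; omega)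
    rw [← hw] at hd
    exact ⟨_, (join_trim_unique φ.2.1 (h.reduced.trim _)
      fun x => (haw φ x).trans (hd x)).2⟩
  choose q hq using hlong
  classical
  refine Finite.of_injective (β := (Fin r × {w : List (Fin n) // w.length ≤ D + k}) ⊕ T.State)
    (fun φ => if hφ : (w φ).length ≤ D + k then .inl (a φ, ⟨w φ, hφ⟩) else .inr (q φ hφ))
    fun φ φ' hφ => Subtype.ext ?_
  by_cases h1 : (w φ).length ≤ D + k <;> by_cases h2 : (w φ').length ≤ D + k
  · simp only [h1, h2, dite_true, Sum.inl.injEq, Prod.mk.injEq, Subtype.mk.injEq] at hφ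
    refine (join_trim_unique φ.2.1 φ'.2.1 (c := c φ) (d := c φ') fun x => ?_).2
    have h3 := haw φ x
    rw [hφ.1, hφ.2] at h3
    exact h3.trans (haw φ' x).symm
  · simp [h1, h2] at hφ
  · simp [h1, h2] at hφ
  · simp only [h1, h2, dite_false, Sum.inr.injEq] at hφ
    rw [hq φ h1, hq φ' h2, hφ]

/-- A continuous injection whose deep local actions are described by a reduced transducer `T`
is induced by a finite minimal synchronizing transducer with core `T`. -/
theorem IsCoreOf.exists_initialTransducer [NeZero r] {T : Transducer.{u} n} (h : IsCoreOf T f)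
    (hn : 2 ≤ n) (hc : Continuous f) (hi : Function.Injective f) :
    ∃ A : InitialTransducer.{0} n r, A.map = f ∧ A.IsFiniteMinimalSynchronizing ∧
      Nonempty (A.core.Iso T) := by
  have : NeZero n := ⟨by omega⟩
  have hfin := h.finite_RState
  set A := minimalTransducer hn hc hi hfin with hA
  obtain ⟨D, k, τ, hsurj, hloc⟩ := h.exists_local
  have hmem : ∀ q, ∃ c, IsRestriction f fun x => join c (T.map q x) := by
    intro q
    obtain ⟨v, hv, rfl⟩ := hsurj q
    obtain ⟨c, hc⟩ := hloc 0 (List.replicate D 0) v (by simp) hv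
    exact ⟨c, 0, _, fun x => (hc x).symm⟩
  let F : T.State → SState f := fun q => ⟨T.map q, h.reduced.trim q, hmem q⟩
  have hrun : ∀ (q : A.R ⊕ A.inner.State) (u v : List (Fin n)), D ≤ u.length → v.length = k →
      A.run (u ++ v) q = .inr (F (τ v)) := by
    intro q u v hu hv
    obtain ⟨a, w, rfl⟩ := exists_eq_stateOf hn hi q
    refine (stateOf_append hn hi a w (u ++ v)).trans ?_
    obtain ⟨c, hc⟩ := hloc a (w ++ u) v (by simp; omega) hv
    rw [List.append_assoc] at hc
    exact stateOf_inr hn hi _ (φ := F (τ v)) hc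
  have hsplit : ∀ w : List (Fin n), D + k ≤ w.length →
      ∃ u v, w = u ++ v ∧ D ≤ u.length ∧ v.length = k := fun w hw =>
    ⟨w.take (w.length - k), w.drop (w.length - k), (List.take_append_drop _ _).symm,
      by simp; omega, by simp; omega⟩
  have hsync : A.SynchronizingAt (D + k) := by
    intro w hw q q'
    obtain ⟨u, v, rfl, hu, hv⟩ := hsplit w hw.ge
    rw [hrun q u v hu hv, hrun q' u v hu hv]
  have hcore : ∀ q, A.IsCoreState (F q) := by
    intro q
    obtain ⟨v, hv, rfl⟩ := hsurj q
    exact ⟨D + k, hsync, List.replicate D 0 ++ v, by simp [hv],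
      fun q => hrun q _ v (by simp) hv⟩
  refine ⟨A, minimalTransducer_map hn hc hi hfin, ⟨h.finite_SState,
    minimalTransducer_isMinimal hn hc hi hfin, D + k, hsync⟩, ?_⟩
  let G : T.State → A.core.State := fun q => ⟨F q, hcore q⟩
  have hG : Function.Bijective G := by
    constructor
    · intro q q' hq
      have h1 : F q = F q' := congrArg (fun s : A.core.State => s.1) hq
      exact h.reduced.map_injective (congrArg Subtype.val h1)
    · rintro ⟨s, hs⟩
      obtain ⟨l, hl, w, hw, hws⟩ := hs
      obtain ⟨u, v, huv, hu, hv⟩ := hsplit (List.replicate (D + k) 0 ++ w) (by simp)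
      refine ⟨τ v, Subtype.ext ?_⟩
      have h1 := hrun (.inr s) u v hu hv
      rw [← huv, InitialTransducer.run_append, hws] at h1
      exact (Sum.inr_injective h1).symm
  have hread : ∀ i q, SState.read hn hi i (F q) = (T.out i q, F (T.next i q)) := by
    intro i q
    obtain ⟨h1, h2⟩ := prepend_trim_unique (SState.read hn hi i (F q)).2.2.1
      (h.reduced.trim (T.next i q)) (u := (SState.read hn hi i (F q)).1) (w := T.out i q)
      fun x => by
        rw [← SState.read_spec hn hi i (F q) x]
        have := T.map_prepend q [i] x
        simpa [Transducer.wr, Transducer.st, runOut, runState] using this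
    exact Prod.ext h1 (Subtype.ext h2)
  let e : T.State ≃ A.core.State := Equiv.ofBijective G hG
  refine ⟨⟨e.symm, fun i s => ?_, fun i s => ?_⟩⟩
  · obtain ⟨q, rfl⟩ := e.surjective s
    rw [Equiv.symm_apply_eq, Equiv.symm_apply_apply]
    exact Subtype.ext (congrArg Prod.snd (hread i q))
  · obtain ⟨q, rfl⟩ := e.surjective s
    rw [Equiv.symm_apply_apply]
    exact congrArg Prod.fst (hread i q)

end Construction

/-! ### Membership in terms of local actions -/

section Membership

variable {n r : ℕ}

/-- The homeomorphism of an element of `B_{n,r}`, the core of the element and the core of the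
inverse. -/
theorem Transducer.InOnr.exists_homeo [NeZero n] [NeZero r] {g : Transducer.{u} n}
    (h : g.InOnr r) : ∃ (f : CantorR n r ≃ₜ CantorR n r) (T : Transducer.{0} n),
      IsCoreOf g f ∧ IsCoreOf T f.symm := by
  obtain ⟨A, ⟨hA, hA', B, hB, hl, hr⟩, ⟨e⟩⟩ := h
  refine ⟨hA.homeomorph, B.core, hA'.isCoreOf.of_iso e, ?_⟩
  have : ⇑hA.homeomorph.symm = B.map := by
    funext x
    rw [Homeomorph.symm_apply_eq]
    exact (hr x).symm
  rw [this]
  exact hB.isCoreOf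

theorem exists_inB (hn : 2 ≤ n) [NeZero r] {g : Transducer.{u} n} {T : Transducer.{v} n}
    (f : CantorR n r ≃ₜ CantorR n r) (hf : IsCoreOf g f) (hT : IsCoreOf T f.symm) :
    ∃ A : InitialTransducer.{0} n r, A.map = f ∧ A.InB ∧ Nonempty (A.core.Iso g) := by
  obtain ⟨A, hA, hA', e⟩ := hf.exists_initialTransducer hn f.continuous f.injective
  obtain ⟨B, hB, hB', -⟩ := hT.exists_initialTransducer hn f.symm.continuous f.symm.injective
  refine ⟨A, hA, ⟨?_, hA', B, hB', ?_, ?_⟩, e⟩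
  · rw [hA]; exact f.isHomeomorph
  · rw [hA, hB]; exact f.symm_apply_apply
  · rw [hA, hB]; exact f.apply_symm_apply

end Membership

/-! ### Convexity of the images of the states -/

section Convexity

variable {n r : ℕ}

/-- `z` lies strictly between `x` and `y` in the lexicographic order. -/
def LexBetween (x z y : Cantor n) : Prop :=
  (LexLT x z ∧ LexLT z y) ∨ (LexLT y z ∧ LexLT z x)

/-- `φ` preserves the lexicographic order. -/
def LexMono (φ : Cantor n → Cantor n) : Prop := ∀ x y, LexLT x y → LexLT (φ x) (φ y)

/-- `φ` reverses the lexicographic order. -/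
def LexAnti (φ : Cantor n → Cantor n) : Prop := ∀ x y, LexLT x y → LexLT (φ y) (φ x)

theorem LexMono.lexLT_iff {φ : Cantor n → Cantor n} (h : LexMono φ) {x y : Cantor n} :
    LexLT (φ x) (φ y) ↔ LexLT x y := by
  refine ⟨fun hxy => ?_, h x y⟩
  rcases lexLT_trichotomy x y with h1 | rfl | h1
  · exact h1
  · exact (hxy.ne rfl).elim
  · exact (hxy.asymm (h _ _ h1)).elim

theorem LexAnti.lexLT_iff {φ : Cantor n → Cantor n} (h : LexAnti φ) {x y : Cantor n} :
    LexLT (φ x) (φ y) ↔ LexLT y x := by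
  refine ⟨fun hxy => ?_, h y x⟩
  rcases lexLT_trichotomy x y with h1 | rfl | h1
  · exact (hxy.asymm (h _ _ h1)).elim
  · exact (hxy.ne rfl).elim
  · exact h1

theorem lexBetween_map_iff {φ : Cantor n → Cantor n} (h : LexMono φ ∨ LexAnti φ)
    {x z y : Cantor n} : LexBetween (φ x) (φ z) (φ y) ↔ LexBetween x z y := by
  rcases h with h | h
  · simp only [LexBetween, h.lexLT_iff]
  · simp only [LexBetween, h.lexLT_iff]
    tauto

theorem isPrefixOf_of_lexLT {w : List (Fin n)} {x y z : Cantor n}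
    (h1 : LexLT (prepend w x) z) (h2 : LexLT z (prepend w y)) : IsPrefixOf w z := by
  obtain ⟨i, hi, hi'⟩ := lexLT_iff.mp h1
  obtain ⟨j, hj, hj'⟩ := lexLT_iff.mp h2
  have key : w.length ≤ i := by
    by_contra hlt
    push Not at hlt
    have hwi : ∀ l ≤ i, prepend w x l = prepend w y l := fun l hl => by
      rw [prepend_of_lt _ _ (by omega), prepend_of_lt _ _ (by omega)]
    rcases lt_trichotomy j i with h | rfl | h
    · rw [← hi j h, hwi j h.le] at hj'
      exact lt_irrefl _ hj'
    · rw [hwi j le_rfl] at hi'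
      exact lt_asymm hi' hj'
    · rw [hwi i le_rfl, ← hj i h] at hi'
      exact lt_irrefl _ hi'
  have h3 : initialWord z w.length = initialWord (prepend w x) w.length :=
    initialWord_eq_iff.mpr fun l hl => (hi l (by omega)).symm
  rw [initialWord_prepend] at h3
  rw [← h3]
  exact isPrefixOf_initialWord _ _

theorem LexBetween.isPrefixOf {w : List (Fin n)} {x y z : Cantor n}
    (h : LexBetween (prepend w x) z (prepend w y)) : IsPrefixOf w z := by
  rcases h with ⟨h1, h2⟩ | ⟨h1, h2⟩
  · exact isPrefixOf_of_lexLT h1 h2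
  · exact isPrefixOf_of_lexLT h1 h2

theorem lexBetween_prepend {w : List (Fin n)} {x y z : Cantor n} :
    LexBetween (prepend w x) (prepend w z) (prepend w y) ↔ LexBetween x z y := by
  simp only [LexBetween, lexLT_prepend]

theorem IsCoreOf.exists_eq_join [NeZero n] [NeZero r] {T : Transducer.{u} n}
    {f : CantorR n r → CantorR n r} (h : IsCoreOf T f) (q : T.State) :
    ∃ d c : Fin r × List (Fin n), ∀ x, f (join d x) = join c (T.map q x) := by
  obtain ⟨D, k, τ, hsurj, hloc⟩ := h.exists_local
  obtain ⟨v, hv, rfl⟩ := hsurj q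
  exact ⟨_, hloc 0 (List.replicate D 0) v (by simp) hv⟩

theorem isOpen_range_join [NeZero n] (c : Fin r × List (Fin n)) :
    IsOpen (Set.range (join c)) := by
  have : Set.range (join c) = (fun z : CantorR n r => z.1) ⁻¹' {c.1} ∩
      (fun z : CantorR n r => z.2) ⁻¹' {y | initialWord y c.2.length
        = initialWord (prepend c.2 0) c.2.length} := by
    ext ⟨b, y⟩
    simp only [Set.mem_range, Set.mem_inter_iff, Set.mem_preimage, Set.mem_singleton_iff,
      Set.mem_ofPred_eq, initialWord_prepend]
    constructor
    · rintro ⟨x, hx⟩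
      obtain ⟨rfl, rfl⟩ := Prod.mk.inj hx
      exact ⟨rfl, initialWord_prepend _ _⟩
    · rintro ⟨rfl, h⟩
      obtain ⟨x, hx⟩ := isPrefixOf_initialWord y c.2.length
      rw [h] at hx
      exact ⟨x, Prod.ext rfl hx.symm⟩
  rw [this]
  exact ((isOpen_discrete _).preimage continuous_fst).inter
    ((isOpen_cone _ _).preimage continuous_snd)

theorem IsCoreOf.isOpen_range_map [NeZero n] [NeZero r] {T : Transducer.{u} n}
    {f : CantorR n r ≃ₜ CantorR n r} (h : IsCoreOf T f) (q : T.State) :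
    IsOpen (Set.range (T.map q)) := by
  obtain ⟨d, c, hc⟩ := h.exists_eq_join q
  have : Set.range (T.map q) = join c ⁻¹' (f '' Set.range (join d)) := by
    ext y
    constructor
    · rintro ⟨x, rfl⟩
      exact ⟨_, ⟨x, rfl⟩, hc x⟩
    · rintro ⟨_, ⟨x, rfl⟩, hx⟩
      rw [hc] at hx
      exact ⟨x, join_injective c hx⟩
  rw [this]
  exact (f.isOpenMap _ (isOpen_range_join d)).preimage (continuous_join c)

theorem IsCoreOf.map_injective [NeZero n] [NeZero r] {T : Transducer.{u} n}
    {f : CantorR n r → CantorR n r} (h : IsCoreOf T f) (hf : Function.Injective f) (q : T.State) :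
    Function.Injective (T.map q) := by
  obtain ⟨d, c, hc⟩ := h.exists_eq_join q
  intro x y hxy
  have := hc x
  rw [hxy, ← hc] at this
  exact join_injective d (hf this)

/-- If the states of the core of a homeomorphism preserve or reverse the lexicographic order, their
images are convex. Indeed the image of a state `p` contains a cone, and some other cone is mapped
into it; every state `q` is reached from `p` inside the latter cone, so that a copy of the image of
`q` is the image of a convex set under an order isomorphism onto a convex set. -/
theorem IsCoreOf.convex_range [NeZero n] [NeZero r] {T : Transducer.{u} n}
    {f : CantorR n r ≃ₜ CantorR n r} (h : IsCoreOf T f)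
    (hT : ∀ q, LexMono (T.map q) ∨ LexAnti (T.map q)) (q : T.State) {x y z : Cantor n}
    (hz : LexBetween (T.map q x) z (T.map q y)) : z ∈ Set.range (T.map q) := by
  obtain ⟨D, k, τ, hsurj, hst, -⟩ := h.exists_sync
  obtain ⟨v, hv, rfl⟩ := hsurj q
  set p := τ v
  obtain ⟨l, hl⟩ := exists_cone_subset (h.isOpen_range_map p) (Set.mem_range_self 0)
  obtain ⟨m, hm⟩ := exists_initialWord_of_continuous (T.continuous_map p) 0 l
  set u := initialWord (T.map p 0) l with hu
  set w := initialWord (0 : Cantor n) m ++ v with hw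
  have hstate : T.st w p = p := by
    rw [hw, Transducer.st, InitialTransducer.runState_append]
    exact hst _ v hv
  have hpre : ∀ x, IsPrefixOf u (prepend (T.wr w p) (T.map p x)) := by
    intro x
    have h1 := T.map_prepend p w x
    rw [hstate] at h1
    rw [← h1, ← hm]
    · exact isPrefixOf_initialWord _ _
    · rw [hw, prepend_append]
      have := initialWord_prepend (initialWord (0 : Cantor n) m) (prepend v x)
      rwa [length_initialWord] at this
  have hz' := lexBetween_prepend (w := T.wr w p).mpr hz
  obtain ⟨x', hx'⟩ := hpre x
  obtain ⟨y', hy'⟩ := hpre y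
  have hzu : IsPrefixOf u (prepend (T.wr w p) z) := by
    rw [hx', hy'] at hz'
    exact hz'.isPrefixOf
  obtain ⟨t, ht⟩ : prepend (T.wr w p) z ∈ Set.range (T.map p) := by
    apply hl
    have := hzu.initialWord_eq
    rw [hu, length_initialWord] at this
    exact this
  have hp := fun x => T.map_prepend p w x
  rw [hstate] at hp
  rw [← ht, ← hp, ← hp, lexBetween_map_iff (hT p)] at hz'
  obtain ⟨t', rfl⟩ := hz'.isPrefixOf
  rw [hp] at ht
  exact ⟨t', prepend_injective _ ht⟩

end Convexity

/-! ### Viable combinations -/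

section Viable

variable {n r : ℕ}

/-- If the images of all states are convex, the parts of a viable combination can be sorted. -/
theorem Transducer.IsViable.exists_isLexViable [NeZero n] {g : Transducer.{u} n}
    (hconv : ∀ (q : g.State) (x y z : Cantor n), LexBetween (g.map q x) z (g.map q y) →
      z ∈ Set.range (g.map q))
    {j : ℕ} {ρ : Fin j → List (Fin n)} {p : Fin j → g.State} (h : g.IsViable ρ p) :
    ∃ (ρ' : Fin j → List (Fin n)) (p' : Fin j → g.State), g.IsLexViable ρ' p' := by
  have hconv' : ∀ (ρ : List (Fin n)) (q : g.State) (x y z : Cantor n),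
      x ∈ g.prefixedImage ρ q → y ∈ g.prefixedImage ρ q → LexLT x z → LexLT z y →
      z ∈ g.prefixedImage ρ q := by
    rintro ρ q _ _ z ⟨_, ⟨x, rfl⟩, rfl⟩ ⟨_, ⟨y, rfl⟩, rfl⟩ hxz hzy
    obtain ⟨t, rfl⟩ := isPrefixOf_of_lexLT hxz hzy
    rw [lexLT_prepend] at hxz hzy
    exact ⟨t, hconv q x y t (Or.inl ⟨hxz, hzy⟩), rfl⟩
  have hdisj : ∀ i l, i ≠ l → ∀ x, x ∈ g.prefixedImage (ρ i) (p i) →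
      x ∉ g.prefixedImage (ρ l) (p l) := by
    intro i l hil x hx hx'
    rcases lt_or_gt_of_ne hil with hlt | hlt
    · exact (h.2 i l hlt).subset ⟨hx, hx'⟩
    · exact (h.2 l i hlt).subset ⟨hx', hx⟩
  let c : Fin j → Lex (Cantor n) := fun i => toLex (prepend (ρ i) (g.map (p i) 0))
  have hc : ∀ i, ofLex (c i) ∈ g.prefixedImage (ρ i) (p i) := fun i => ⟨_, ⟨0, rfl⟩, rfl⟩
  have hcinj : Function.Injective c := by
    intro i l hil
    by_contra hne
    exact hdisj i l hne _ (hc i) (by rw [hil]; exact hc l)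
  set σ := Tuple.sort c
  have hmono : StrictMono (c ∘ σ) :=
    (Tuple.monotone_sort c).strictMono_of_injective (hcinj.comp σ.injective)
  refine ⟨ρ ∘ σ, p ∘ σ, ⟨?_, ?_⟩, ?_⟩
  · rw [← h.1]
    exact σ.surjective.iUnion_comp (fun i => g.prefixedImage (ρ i) (p i))
  · intro i l hil
    ext x
    simp only [Set.mem_inter_iff, Set.mem_empty_iff_false, iff_false]
    exact fun hx => hdisj _ _ (σ.injective.ne hil.ne) x hx.1 hx.2
  · intro a b hab x hx y hy
    -- by convexity, a point out of order would lie between two points of the other part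
    have hne : σ a ≠ σ b := σ.injective.ne hab.ne
    have hlt : LexLT (ofLex (c (σ a))) (ofLex (c (σ b))) := hmono hab
    have h1 : LexLT x (ofLex (c (σ b))) := by
      rcases lexLT_trichotomy x (ofLex (c (σ b))) with h1 | h1 | h1
      · exact h1
      · exact (hdisj _ _ hne x hx (h1 ▸ hc (σ b))).elim
      · exact (hdisj _ _ hne _ (hconv' _ _ _ _ _ (hc (σ a)) hx hlt h1) (hc (σ b))).elim
    rcases lexLT_trichotomy x y with h2 | h2 | h2
    · exact h2
    · exact (hdisj _ _ hne x hx (h2 ▸ hy)).elim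
    · exact (hdisj _ _ hne x hx (hconv' _ _ _ _ _ hy (hc (σ b)) h2 h1)).elim

/-- The words `a w` with `w` of a fixed large length cut the target of a homeomorphism with core `g`
into `r n^L` parts, which form one viable combination for each of the `r` dotted letters. -/
theorem IsCoreOf.exists_isViable [NeZero n] {g : Transducer.{u} n}
    {f : CantorR n r ≃ₜ CantorR n r} (h : IsCoreOf g f) :
    ∃ (L : ℕ) (j : Fin r → ℕ), (∀ b, ∃ (ρ : Fin (j b) → List (Fin n)) (p : Fin (j b) → g.State),
      g.IsViable ρ p) ∧ ∑ b, j b = r * n ^ L := by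
  classical
  obtain ⟨D, k, τ, hsurj, hloc⟩ := h.exists_local
  let W := Fin r × List.Vector (Fin n) (D + k)
  have hex : ∀ d : W, ∃ (c : Fin r × List (Fin n)) (q : g.State),
      ∀ x, f (join (d.1, d.2.1) x) = join c (g.map q x) := by
    rintro ⟨a, w, hw⟩
    obtain ⟨c, hc⟩ := hloc a (w.take D) (w.drop D) (by simp [hw]) (by simp [hw])
    rw [List.take_append_drop] at hc
    exact ⟨c, _, hc⟩
  choose c q hcq using hex
  let P : Fin r → Type := fun b => {d : W // (c d).1 = b}
  refine ⟨D + k, fun b => Fintype.card (P b), fun b => ?_, ?_⟩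
  · let e : Fin (Fintype.card (P b)) ≃ P b := (Fintype.equivFin (P b)).symm
    refine ⟨fun i => (c (e i).1).2, fun i => q (e i).1, ?_, ?_⟩
    · rw [Set.eq_univ_iff_forall]
      intro y
      obtain ⟨⟨a, x⟩, hx⟩ := f.surjective (b, y)
      let d : W := (a, ⟨initialWord x (D + k), length_initialWord _ _⟩)
      have hd := hcq d (fun i => x (D + k + i))
      have hax : (join (d.1, d.2.1) fun i => x (D + k + i)) = (a, x) :=
        Prod.ext rfl (prepend_initialWord _ _)
      rw [hax, hx] at hd
      have hb : (c d).1 = b := congrArg (fun z : CantorR n r => z.1) hd.symm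
      rw [Set.mem_iUnion]
      refine ⟨e.symm ⟨d, hb⟩, ?_⟩
      simp only [Equiv.apply_symm_apply]
      exact ⟨_, ⟨_, rfl⟩, (congrArg Prod.snd hd).symm⟩
    · intro i l hil
      ext y
      simp only [Set.mem_inter_iff, Set.mem_empty_iff_false, iff_false]
      rintro ⟨⟨_, ⟨x, rfl⟩, hx⟩, ⟨_, ⟨x', rfl⟩, hx'⟩⟩
      have h1 : f (join ((e i).1.1, (e i).1.2.1) x) = f (join ((e l).1.1, (e l).1.2.1) x') := by
        rw [hcq, hcq]
        exact Prod.ext ((e i).2.trans (e l).2.symm) (hx.trans hx'.symm)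
      have h2 := f.injective h1
      have h3 : (e i).1.1 = (e l).1.1 := congrArg (fun z : CantorR n r => z.1) h2
      have h4 : prepend (e i).1.2.1 x = prepend (e l).1.2.1 x' := congrArg Prod.snd h2
      have hlen : (e i).1.2.1.length = (e l).1.2.1.length := by
        rw [(e i).1.2.2, (e l).1.2.2]
      have h5 : (e i).1.2.1 = (e l).1.2.1 := by
        rw [← initialWord_prepend (e i).1.2.1 x, h4, hlen, initialWord_prepend]
      exact hil.ne (e.injective (Subtype.ext (Prod.ext h3 (Subtype.ext h5))))
  · rw [← Fintype.card_sigma, Fintype.card_congr (Equiv.sigmaFiberEquiv fun d : W => (c d).1)]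
    simp [W]

end Viable

/-! ### Twins in terms of the order -/

section Twins

variable {n r : ℕ}

theorem lexLT_update_of_lt {x : Cantor n} {j : ℕ} {i : Fin n} (h : x j < i) :
    LexLT x (Function.update x j i) :=
  ⟨j, fun l hl => by simp [hl.ne], by simpa using h⟩

theorem update_lexLT_of_lt {x : Cantor n} {j : ℕ} {i : Fin n} (h : i < x j) :
    LexLT (Function.update x j i) x :=
  ⟨j, fun l hl => by simp [hl.ne], by simpa using h⟩

theorem forall_eq_zero_iff (x : Cantor n) : (∀ j, (x j : ℕ) = 0) ↔ ∀ z, ¬ LexLT z x := by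
  constructor
  · rintro h z ⟨j, -, hj⟩
    have h1 : z j < x j := hj
    have h2 := h j
    omega
  · intro h j
    by_contra hj
    exact h _ (update_lexLT_of_lt (j := j) (i := ⟨0, (x j).pos⟩) (by simp [Fin.lt_def]; omega))

theorem forall_eq_last_iff (x : Cantor n) : (∀ j, (x j : ℕ) + 1 = n) ↔ ∀ z, ¬ LexLT x z := by
  constructor
  · rintro h z ⟨j, -, hj⟩
    have h1 : x j < z j := hj
    have h2 := h j
    omega
  · intro h j
    by_contra hj
    exact h _ (lexLT_update_of_lt (j := j) (i := ⟨n - 1, by have := (x j).pos; omega⟩)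
      (by simp [Fin.lt_def]; omega))

/-- Twins are the pairs of neighbours in the lexicographic order. -/
theorem twin_iff (x y : Cantor n) :
    Twin x y ↔ LexLT y x ∧ ∀ z, ¬ (LexLT y z ∧ LexLT z x) := by
  constructor
  · rintro ⟨k, h1, h2, h3⟩
    refine ⟨⟨k, fun j hj => (h1 j hj).symm, ?_⟩, ?_⟩
    · change y k < x k
      omega
    · rintro z ⟨hyz, hzx⟩
      obtain ⟨i, hi, hi'⟩ := lexLT_iff.mp hyz
      obtain ⟨l, hl, hl'⟩ := lexLT_iff.mp hzx
      rcases lt_trichotomy i k with hik | rfl | hik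
      · rcases lt_trichotomy l i with hli | rfl | hli
        · have := h1 l (hli.trans hik)
          rw [← hi l hli, this] at hl'
          exact lt_irrefl _ hl'
        · rw [h1 l hik] at hl'
          exact lt_asymm hi' hl'
        · rw [hl i hli, h1 i hik] at hi'
          exact lt_irrefl _ hi'
      · rcases lt_trichotomy l i with hli | rfl | hli
        · have := h1 l hli
          rw [← hi l hli, this] at hl'
          exact lt_irrefl _ hl'
        · omega
        · have := (h3 l hli).1
          omega
      · have := (h3 i hik).2
        omega
  · rintro ⟨hlt, hno⟩
    obtain ⟨k, hk, hk'⟩ := lexLT_iff.mp hlt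
    refine ⟨k, fun j hj => (hk j hj).symm, ?_, fun j hj => ⟨?_, ?_⟩⟩
    · by_contra hne
      refine hno (Function.update y k ⟨(y k : ℕ) + 1, by omega⟩)
        ⟨lexLT_update_of_lt (by simp [Fin.lt_def]), k, fun l hl => ?_, ?_⟩
      · simp [hl.ne, hk l hl]
      · simp [Fin.lt_def]
        omega
    · by_contra hne
      refine hno (Function.update x j ⟨0, (x j).pos⟩)
        ⟨⟨k, fun l hl => ?_, ?_⟩, update_lexLT_of_lt (by simp [Fin.lt_def]; omega)⟩
      · simp [(hl.trans hj).ne, hk l hl]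
      · simpa [hj.ne] using hk'
    · by_contra hne
      refine hno (Function.update y j ⟨n - 1, by have := (y j).pos; omega⟩)
        ⟨lexLT_update_of_lt (by simp [Fin.lt_def]; omega), k, fun l hl => ?_, ?_⟩
      · simp [(hl.trans hj).ne, hk l hl]
      · simpa [hj.ne] using hk'

/-- The lexicographic order on a disjoint union of copies of the Cantor space. -/
def BlockLT {ι : Type*} [LT ι] (x y : ι × Cantor n) : Prop :=
  x.1 < y.1 ∨ x.1 = y.1 ∧ LexLT x.2 y.2

theorem BlockLT.ne {ι : Type*} [Preorder ι] {x y : ι × Cantor n} (h : BlockLT x y) : x ≠ y := by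
  rintro rfl
  rcases h with h | h
  · exact lt_irrefl _ h
  · exact h.2.ne rfl

theorem BlockLT.asymm {ι : Type*} [Preorder ι] {x y : ι × Cantor n} (h : BlockLT x y) :
    ¬ BlockLT y x := by
  rintro (h' | h') <;> rcases h with h | h
  · exact lt_asymm h h'
  · exact h'.ne h.1.symm
  · exact h.ne h'.1.symm
  · exact h.2.asymm h'.2

theorem blockLT_trichotomy {ι : Type*} [LinearOrder ι] (x y : ι × Cantor n) :
    BlockLT x y ∨ x = y ∨ BlockLT y x := by
  rcases lt_trichotomy x.1 y.1 with h | h | h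
  · exact Or.inl (Or.inl h)
  · rcases lexLT_trichotomy x.2 y.2 with h' | h' | h'
    · exact Or.inl (Or.inr ⟨h, h'⟩)
    · exact Or.inr (Or.inl (Prod.ext h h'))
    · exact Or.inr (Or.inr (Or.inr ⟨h.symm, h'⟩))
  · exact Or.inr (Or.inr (Or.inl h))

/-- Twins of the `r`-fold Cantor space are neighbours, or the least and the greatest point. -/
theorem twinR_iff (x y : CantorR n r) :
    TwinR x y ↔ (BlockLT y x ∧ ∀ z : CantorR n r, ¬ (BlockLT y z ∧ BlockLT z x)) ∨
      ((∀ z : CantorR n r, ¬ BlockLT z x) ∧ ∀ z : CantorR n r, ¬ BlockLT y z) := by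
  constructor
  · rintro (⟨h1, h2⟩ | ⟨h1 | h1, h2⟩)
    · obtain ⟨h3, h4⟩ := (twin_iff _ _).mp h2
      refine Or.inl ⟨Or.inr ⟨h1.symm, h3⟩, fun z hz => ?_⟩
      rcases hz with ⟨h5 | h5, h6 | h6⟩
      · omega
      · omega
      · omega
      · exact h4 _ ⟨h5.2, h6.2⟩
    · have h3 := (forall_eq_zero_iff x.2).mp fun j => (h2 j).1
      have h4 := (forall_eq_last_iff y.2).mp fun j => (h2 j).2
      refine Or.inl ⟨Or.inl (by omega), fun z hz => ?_⟩
      rcases hz with ⟨h5 | h5, h6 | h6⟩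
      · omega
      · exact h3 _ h6.2
      · exact h4 _ h5.2
      · exact h3 _ h6.2
    · have h3 := (forall_eq_zero_iff x.2).mp fun j => (h2 j).1
      have h4 := (forall_eq_last_iff y.2).mp fun j => (h2 j).2
      refine Or.inr ⟨fun z hz => ?_, fun z hz => ?_⟩
      · rcases hz with h5 | h5
        · omega
        · exact h3 _ h5.2
      · rcases hz with h5 | h5
        · omega
        · exact h4 _ h5.2
  · rintro (⟨h1, h2⟩ | ⟨h1, h2⟩)
    · rcases h1 with h1 | h1
      · refine Or.inr ⟨Or.inl ?_, fun j => ⟨?_, ?_⟩⟩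
        · by_contra hne
          exact h2 (⟨(y.1 : ℕ) + 1, by omega⟩, x.2)
            ⟨Or.inl (by simp [Fin.lt_def]), Or.inl (by simp [Fin.lt_def]; omega)⟩
        · exact (forall_eq_zero_iff x.2).mpr
            (fun z hz => h2 (x.1, z) ⟨Or.inl h1, Or.inr ⟨rfl, hz⟩⟩) j
        · exact (forall_eq_last_iff y.2).mpr
            (fun z hz => h2 (y.1, z) ⟨Or.inr ⟨rfl, hz⟩, Or.inl h1⟩) j
      · refine Or.inl ⟨h1.1.symm, (twin_iff _ _).mpr ⟨h1.2, fun z hz => ?_⟩⟩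
        exact h2 (x.1, z) ⟨Or.inr ⟨h1.1, hz.1⟩, Or.inr ⟨rfl, hz.2⟩⟩
    · refine Or.inr ⟨Or.inr ⟨?_, ?_⟩, fun j => ⟨?_, ?_⟩⟩
      · by_contra hne
        exact h1 (⟨0, x.1.pos⟩, x.2) (Or.inl (by simp [Fin.lt_def]; omega))
      · by_contra hne
        exact h2 (⟨r - 1, by omega⟩, y.2) (Or.inl (by simp [Fin.lt_def]; omega))
      · exact (forall_eq_zero_iff x.2).mpr (fun z hz => h1 (x.1, z) (Or.inr ⟨rfl, hz⟩)) j
      · exact (forall_eq_last_iff y.2).mpr (fun z hz => h2 (y.1, z) (Or.inr ⟨rfl, hz⟩)) j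

/-- A monotone bijection maps twins to twins. -/
theorem TwinR.map_of_mono {F : CantorR n r → CantorR n r} (hF : Function.Surjective F)
    (hmono : ∀ x y, BlockLT x y ↔ BlockLT (F x) (F y)) {x y : CantorR n r} (h : TwinR x y) :
    TwinR (F x) (F y) := by
  rw [twinR_iff] at h ⊢
  rw [← hmono, hF.forall (p := fun z => ¬ (BlockLT (F y) z ∧ BlockLT z (F x))),
    hF.forall (p := fun z => ¬ BlockLT z (F x)), hF.forall (p := fun z => ¬ BlockLT (F y) z)]
  simpa only [← hmono] using h

/-- An antitone bijection exchanges the two members of a pair of twins. -/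
theorem TwinR.map_of_anti {F : CantorR n r → CantorR n r} (hF : Function.Surjective F)
    (hanti : ∀ x y, BlockLT x y ↔ BlockLT (F y) (F x)) {x y : CantorR n r} (h : TwinR x y) :
    TwinR (F y) (F x) := by
  rw [twinR_iff] at h ⊢
  rw [← hanti, hF.forall (p := fun z => ¬ (BlockLT (F x) z ∧ BlockLT z (F y))),
    hF.forall (p := fun z => ¬ BlockLT z (F y)), hF.forall (p := fun z => ¬ BlockLT (F x) z)]
  simp only [← hanti]
  rcases h with ⟨h1, h2⟩ | ⟨h1, h2⟩
  · exact Or.inl ⟨h1, fun z hz => h2 z hz.symm⟩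
  · exact Or.inr ⟨h2, h1⟩

theorem circleEquiv_map_of_mono {F : CantorR n r → CantorR n r} (hF : Function.Surjective F)
    (h : (∀ x y, BlockLT x y → BlockLT (F x) (F y)) ∨ ∀ x y, BlockLT x y → BlockLT (F y) (F x))
    {x y : CantorR n r} (hxy : CircleEquiv x y) : CircleEquiv (F x) (F y) := by
  rcases h with h | h
  · have hiff : ∀ x y, BlockLT x y ↔ BlockLT (F x) (F y) := fun x y => by
      refine ⟨h x y, fun hlt => ?_⟩
      rcases blockLT_trichotomy x y with h1 | rfl | h1
      · exact h1
      · exact (hlt.ne rfl).elim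
      · exact (hlt.asymm (h _ _ h1)).elim
    rcases hxy with rfl | hxy | hxy
    · exact Or.inl rfl
    · exact Or.inr (Or.inl (hxy.map_of_mono hF hiff))
    · exact Or.inr (Or.inr (hxy.map_of_mono hF hiff))
  · have hiff : ∀ x y, BlockLT x y ↔ BlockLT (F y) (F x) := fun x y => by
      refine ⟨h x y, fun hlt => ?_⟩
      rcases blockLT_trichotomy x y with h1 | rfl | h1
      · exact h1
      · exact (hlt.ne rfl).elim
      · exact (hlt.asymm (h _ _ h1)).elim
    rcases hxy with rfl | hxy | hxy
    · exact Or.inl rfl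
    · exact Or.inr (Or.inr (hxy.map_of_anti hF hiff))
    · exact Or.inr (Or.inl (hxy.map_of_anti hF hiff))

end Twins

/-! ### Homeomorphisms built from the states of a core -/

section Assembly

variable {n r s : ℕ}

/-- The map of `N` copies of the Cantor space which is given on the `l`-th copy by `φ_l`, followed
by writing the word `c_l` in front. -/
def assemble {N : ℕ} (c : Fin N → Fin r × List (Fin n)) (φ : Fin N → Cantor n → Cantor n)
    (x : CantorR n N) : CantorR n r := join (c x.1) (φ x.1 x.2)

theorem continuous_assemble {N : ℕ} (c : Fin N → Fin r × List (Fin n))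
    {φ : Fin N → Cantor n → Cantor n} (hφ : ∀ l, Continuous (φ l)) :
    Continuous (assemble c φ) :=
  continuous_prod_of_discrete_left.mpr fun l => (continuous_join (c l)).comp (hφ l)

/-- A continuous map to a discrete space is constant on all cones of some fixed depth. -/
theorem exists_forall_cone_eq {N : ℕ} {κ : CantorR n r → Fin N} (hκ : Continuous κ) :
    ∃ L, ∀ (b : Fin r) (z : List (Fin n)), L ≤ z.length → ∀ x y,
      κ (join (b, z) x) = κ (join (b, z) y) := by
  have hloc : ∀ P : CantorR n r, ∃ k, ∀ y, initialWord y k = initialWord P.2 k →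
      κ (P.1, y) = κ P := by
    intro P
    have hopen : IsOpen {y : Cantor n | κ (P.1, y) = κ P} :=
      (isOpen_discrete {κ P}).preimage (hκ.comp (continuous_const.prodMk continuous_id))
    exact exists_cone_subset hopen (x := P.2) rfl
  choose k hk using hloc
  let U : CantorR n r → Set (CantorR n r) := fun P =>
    (fun z : CantorR n r => z.1) ⁻¹' {P.1} ∩
      (fun z : CantorR n r => z.2) ⁻¹' {y | initialWord y (k P) = initialWord P.2 (k P)}
  have hU : ∀ P ∈ Set.univ, U P ∈ nhds P := fun P _ =>
    (((isOpen_discrete _).preimage continuous_fst).inter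
      ((isOpen_cone _ _).preimage continuous_snd)).mem_nhds ⟨rfl, rfl⟩
  obtain ⟨t, ht⟩ := isCompact_univ.elim_nhds_subcover' (fun P _ => U P) hU
  refine ⟨t.sup fun P => k P.1, fun b z hz x y => ?_⟩
  obtain ⟨P, hPt, hP1, hP2⟩ : ∃ P ∈ t, join (b, z) x ∈ U P.1 := by
    simpa using ht (Set.mem_univ (join (b, z) x))
  have hb : b = P.1.1 := hP1
  have hx : initialWord (prepend z x) (k P.1) = initialWord P.1.2 (k P.1) := hP2
  have hkz : k P.1 ≤ z.length := (Finset.le_sup (f := fun P => k P.1) hPt).trans hz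
  have hxy : initialWord (prepend z y) (k P.1) = initialWord (prepend z x) (k P.1) :=
    initialWord_eq_iff.mpr fun i hi => by
      rw [prepend_of_lt _ _ (hi.trans_le hkz), prepend_of_lt _ _ (hi.trans_le hkz)]
  subst hb
  exact (hk _ _ hx).trans (hk _ _ (hxy.trans hx)).symm

/-- If `f` maps every cone of a partition to a set `c_l im(p_l)` by the corresponding state of `g`,
and `g` is the core of some homeomorphism `f₀`, then `g` is also the core of `f`, and the cores of
the inverses coincide. -/
theorem exists_homeo_of_assemble [NeZero n] [NeZero r] [NeZero s] {g : Transducer.{u} n}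
    {T : Transducer.{v} n} {f₀ : CantorR n s ≃ₜ CantorR n s} (hg : IsCoreOf g f₀)
    (hT : IsCoreOf T f₀.symm) {N : ℕ} (d c : Fin N → Fin r × List (Fin n)) (p : Fin N → g.State)
    (hd : Function.Bijective (assemble d fun _ => id))
    (hc : Function.Bijective (assemble c fun l => g.map (p l))) :
    ∃ f : CantorR n r ≃ₜ CantorR n r, IsCoreOf g f ∧ IsCoreOf T f.symm ∧
      ∀ l x, f (join (d l) x) = join (c l) (g.map (p l) x) := by
  let U : CantorR n N ≃ₜ CantorR n r := Continuous.homeoOfEquivCompactToT2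
    (f := Equiv.ofBijective _ hd) (continuous_assemble d fun _ => continuous_id)
  let V : CantorR n N ≃ₜ CantorR n r := Continuous.homeoOfEquivCompactToT2
    (f := Equiv.ofBijective _ hc) (continuous_assemble c fun l => g.continuous_map (p l))
  have hU : ∀ l x, U (l, x) = join (d l) x := fun _ _ => rfl
  have hV : ∀ l x, V (l, x) = join (c l) (g.map (p l) x) := fun _ _ => rfl
  let f := U.symm.trans V
  have hf : ∀ l x, f (join (d l) x) = join (c l) (g.map (p l) x) := by
    intro l x
    rw [← hU, ← hV]
    exact congrArg V (U.symm_apply_apply _)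
  refine ⟨f, ⟨hg.reduced, ?_⟩, ⟨hT.reduced, ?_⟩, hf⟩
  · obtain ⟨D, k, τ, hsurj, hst, -⟩ := hg.exists_sync
    refine ⟨Finset.univ.sup fun l => (d l).2.length, k, τ, hsurj, fun a w v hw hv => ?_⟩
    obtain ⟨⟨l, y⟩, hy⟩ := U.surjective (join (a, w) 0)
    rw [hU] at hy
    obtain rfl : (d l).1 = a := congrArg (fun z : CantorR n r => z.1) hy
    obtain ⟨t, ht, -⟩ := exists_append_of_prepend_eq (congrArg Prod.snd hy)
      ((Finset.le_sup (f := fun l => (d l).2.length) (Finset.mem_univ l)).trans hw)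
    simp only at ht
    subst ht
    refine ⟨((c l).1, (c l).2 ++ g.wr (t ++ v) (p l)), fun x => ?_⟩
    rw [List.append_assoc, join_append, hf, g.map_prepend, join_append, Transducer.st,
      InitialTransducer.runState_append, ← hst _ v hv]
  · obtain ⟨D, k, τ, hsurj, hloc⟩ := hT.exists_local
    -- below depth `L`, the inverse map takes a cone into a single cone of the first partition
    obtain ⟨L, hL⟩ := exists_forall_cone_eq (n := n) (r := r) (κ := fun z => (V.symm z).1)
      (continuous_fst.comp V.symm.continuous)
    refine ⟨L + (Finset.univ.sup fun l => (c l).2.length) + D, k, τ, hsurj, fun b w v hw hv => ?_⟩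
    obtain ⟨l, hl⟩ : ∃ l, ∀ x, ∃ y, V (l, y) = join (b, w) x :=
      ⟨(V.symm (join (b, w) 0)).1, fun x => ⟨(V.symm (join (b, w) x)).2, by
        rw [hL b w (by omega) 0 x]
        exact V.apply_symm_apply _⟩⟩
    choose y hy using hl
    simp only [hV] at hy
    obtain rfl : (c l).1 = b := congrArg (fun z : CantorR n r => z.1) (hy 0)
    have hcl : (c l).2.length ≤ Finset.univ.sup fun l => (c l).2.length :=
      Finset.le_sup (f := fun l => (c l).2.length) (Finset.mem_univ l)
    obtain ⟨t, ht, -⟩ := exists_append_of_prepend_eq (congrArg Prod.snd (hy 0))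
      (by simp only; omega)
    simp only at ht
    subst ht
    have hy' : ∀ x, g.map (p l) (y x) = prepend t x := fun x => by
      have := hy x
      rw [join_append] at this
      exact join_injective _ this
    obtain ⟨e, e', he⟩ := hg.exists_eq_join (p l)
    obtain ⟨c', hc'⟩ := hloc e'.1 (e'.2 ++ t) v (by simp at hw ⊢; omega) hv
    have key : ∀ x, join e (y (prepend v x)) = join c' (T.map (τ v) x) := fun x => by
      rw [← hc', join_append, join_append, ← hy', Homeomorph.eq_symm_apply]
      exact he _
    -- the word `c'` extends `e`, because the images of `τ v` have no common prefix
    obtain ⟨e₂, he₂⟩ : e.2 <+: c'.2 := (hT.reduced.trim (τ v)).prefix_of_forall fun x =>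
      ⟨_, (congrArg Prod.snd (key x)).symm⟩
    refine ⟨((d l).1, (d l).2 ++ e₂), fun x => ?_⟩
    have h1 : y (prepend v x) = prepend e₂ (T.map (τ v) x) := by
      apply prepend_injective e.2
      rw [← prepend_append, he₂]
      exact congrArg Prod.snd (key x)
    rw [join_append, ← hy, Homeomorph.symm_apply_eq, join_append, ← h1, hf]

end Assembly

/-! ### Partitions into cones in increasing order -/

section OrderedPartitions

variable {n r : ℕ}

/-- The `r`-fold Cantor space is cut into `N` cones; the `l`-th cone in the lexicographic order
consists of the points that start with `d l`. -/
def IsOrderedPartition {N : ℕ} (d : Fin N → Fin r × List (Fin n)) : Prop :=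
  Function.Surjective (assemble d fun _ => id) ∧
    ∀ x y : CantorR n N, BlockLT x y →
      BlockLT (assemble d (fun _ => id) x) (assemble d (fun _ => id) y)

theorem injective_of_blockLT {ι : Type*} [LinearOrder ι] {α : Type*} {F : ι × Cantor n → α}
    (h : ∀ x y, BlockLT x y → F x ≠ F y) : Function.Injective F := by
  intro x y hxy
  rcases blockLT_trichotomy x y with h1 | h1 | h1
  · exact (h _ _ h1 hxy).elim
  · exact h1
  · exact (h _ _ h1 hxy.symm).elim

theorem IsOrderedPartition.bijective {N : ℕ} {d : Fin N → Fin r × List (Fin n)}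
    (h : IsOrderedPartition d) : Function.Bijective (assemble d fun _ => id) :=
  ⟨injective_of_blockLT fun x y hxy => (h.2 x y hxy).ne, h.1⟩

theorem lexLT_cons_of_lt {i j : Fin n} (h : i < j) (x y : Cantor n) :
    LexLT (prepend [i] x) (prepend [j] y) :=
  ⟨0, fun _ hl => (Nat.not_lt_zero _ hl).elim, h⟩

/-- The identification of `M + n` copies of the Cantor space with `M + 1` copies, of which the last
one is split according to the first letter. -/
def mergeLast {M : ℕ} (x : CantorR n (M + n)) : CantorR n (M + 1) :=
  Fin.addCases (fun l : Fin M => (l.castSucc, x.2)) (fun i => (Fin.last M, prepend [i] x.2)) x.1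

theorem mergeLast_surjective {M : ℕ} :
    Function.Surjective (mergeLast : CantorR n (M + n) → CantorR n (M + 1)) := by
  rintro ⟨l, x⟩
  induction l using Fin.lastCases with
  | last =>
    refine ⟨(Fin.natAdd M (x 0), fun i => x (1 + i)), ?_⟩
    simp only [mergeLast, Fin.addCases_right]
    exact Prod.ext rfl (prepend_initialWord x 1)
  | cast l => exact ⟨(Fin.castAdd n l, x), by simp only [mergeLast, Fin.addCases_left]⟩

theorem mergeLast_mono {M : ℕ} {x y : CantorR n (M + n)} (h : BlockLT x y) :
    BlockLT (mergeLast x) (mergeLast y) := by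
  obtain ⟨a, x⟩ := x
  obtain ⟨b, y⟩ := y
  induction a using Fin.addCases with
  | left a =>
    induction b using Fin.addCases with
    | left b =>
      simp only [mergeLast, Fin.addCases_left]
      rcases h with h | ⟨h, h'⟩
      · exact Or.inl h
      · exact Or.inr ⟨Fin.ext (congrArg Fin.val h :), h'⟩
    | right b =>
      simp only [mergeLast, Fin.addCases_left, Fin.addCases_right]
      exact Or.inl (Fin.castSucc_lt_last a)
  | right a =>
    induction b using Fin.addCases with
    | left b =>
      simp only [BlockLT, Fin.lt_def, Fin.ext_iff, Fin.val_natAdd, Fin.val_castAdd] at h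
      omega
    | right b =>
      simp only [mergeLast, Fin.addCases_right]
      refine Or.inr ⟨rfl, ?_⟩
      rcases h with h | ⟨h, h'⟩
      · exact lexLT_cons_of_lt (by simpa using h) x y
      · have hab : a = b := by simpa using h
        rw [hab]
        exact lexLT_prepend.mpr h'

theorem IsOrderedPartition.split {M : ℕ} {d : Fin (M + 1) → Fin r × List (Fin n)}
    (h : IsOrderedPartition d) :
    ∃ d' : Fin (M + n) → Fin r × List (Fin n), IsOrderedPartition d' := by
  let d' : Fin (M + n) → Fin r × List (Fin n) := Fin.addCases (fun l => d l.castSucc)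
    fun i => ((d (Fin.last M)).1, (d (Fin.last M)).2 ++ [i])
  have key : assemble d' (fun _ => id) = assemble d (fun _ => id) ∘ mergeLast := by
    funext ⟨a, x⟩
    induction a using Fin.addCases with
    | left a => simp [assemble, mergeLast, d']
    | right a => simp [assemble, mergeLast, d', join_append]
  refine ⟨d', ?_, fun x y hxy => ?_⟩
  · rw [key]
    exact h.1.comp mergeLast_surjective
  · rw [key]
    exact h.2 _ _ (mergeLast_mono hxy)

theorem exists_isOrderedPartition (hn : 2 ≤ n) (hr : 1 ≤ r) {N : ℕ} (hN : r ≤ N)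
    (h : r ≡ N [MOD (n - 1)]) : ∃ d : Fin N → Fin r × List (Fin n), IsOrderedPartition d := by
  obtain ⟨t, ht⟩ := (Nat.modEq_iff_dvd' hN).mp h
  obtain rfl : N = r + (n - 1) * t := by omega
  clear h hN ht
  induction t with
  | zero =>
    have h0 : IsOrderedPartition fun l : Fin r => (l, ([] : List (Fin n))) := by
      have hid : (assemble (fun l : Fin r => (l, ([] : List (Fin n)))) fun _ => id) = id := by
        funext x
        simp [assemble, join]
      unfold IsOrderedPartition
      rw [hid]
      exact ⟨Function.surjective_id, fun _ _ hxy => hxy⟩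
    exact ⟨_, h0⟩
  | succ t ih =>
    obtain ⟨M, hM⟩ : ∃ M, r + (n - 1) * t = M + 1 := ⟨r + (n - 1) * t - 1, by omega⟩
    have hM' : r + (n - 1) * (t + 1) = M + n := by
      rw [mul_add, ← add_assoc, hM]
      omega
    rw [hM] at ih
    rw [hM']
    obtain ⟨d, hd⟩ := ih
    exact hd.split

end OrderedPartitions

/-! ### Assembling lexicographic viable combinations -/

section Combinations

variable {n r s : ℕ}

/-- There are `m` lexicographic viable combinations of total length `J`. -/
def HasLexCombinations (g : Transducer.{u} n) (m J : ℕ) : Prop :=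
  ∃ j : Fin m → ℕ, (∀ i, ∃ (ρ : Fin (j i) → List (Fin n)) (p : Fin (j i) → g.State),
    g.IsLexViable ρ p) ∧ ∑ i, j i = J

theorem HasLexCombinations.add {g : Transducer.{u} n} {m m' J J' : ℕ}
    (h : HasLexCombinations g m J) (h' : HasLexCombinations g m' J') :
    HasLexCombinations g (m + m') (J + J') := by
  obtain ⟨j, hj, rfl⟩ := h
  obtain ⟨j', hj', rfl⟩ := h'
  refine ⟨Fin.append j j', fun i => ?_, by simp [Fin.sum_univ_add]⟩
  induction i using Fin.addCases with
  | left i => rw [Fin.append_left]; exact hj i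
  | right i => rw [Fin.append_right]; exact hj' i

theorem HasLexCombinations.mul {g : Transducer.{u} n} {m J : ℕ}
    (h : HasLexCombinations g m J) (N : ℕ) : HasLexCombinations g (N * m) (N * J) := by
  induction N with
  | zero =>
    rw [zero_mul, zero_mul]
    exact ⟨Fin.elim0, fun i => i.elim0, by simp⟩
  | succ N ih =>
    rw [add_mul, add_mul, one_mul, one_mul]
    exact ih.add h

theorem HasLexCombinations.le [NeZero n] {g : Transducer.{u} n} {m J : ℕ}
    (h : HasLexCombinations g m J) : m ≤ J := by
  obtain ⟨j, hj, rfl⟩ := h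
  have h1 : ∀ i, 1 ≤ j i := by
    intro i
    obtain ⟨ρ, p, h⟩ := hj i
    obtain ⟨l, -⟩ := Set.mem_iUnion.mp (h.1.1.ge (Set.mem_univ 0))
    exact l.pos
  calc m = ∑ i : Fin m, 1 := by simp
    _ ≤ _ := Finset.sum_le_sum fun i _ => h1 i

/-- The parts of `m` lexicographic viable combinations, placed into the `m` cones of an ordered
partition, are numbered in increasing order. -/
theorem exists_sorted_parts {g : Transducer.{u} n} {m J : ℕ} (h : HasLexCombinations g m J)
    (hinj : ∀ q, Function.Injective (g.map q))
    {d : Fin m → Fin r × List (Fin n)} (hd : IsOrderedPartition d) :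
    ∃ (c : Fin J → Fin r × List (Fin n)) (p : Fin J → g.State),
      Function.Bijective (assemble c fun l => g.map (p l)) ∧
      ∀ a b, a < b → ∀ x y, BlockLT (join (c a) (g.map (p a) x)) (join (c b) (g.map (p b) y)) := by
  obtain ⟨j, hj, hJ⟩ := h
  choose ρ p hρ using hj
  let ι := Σₗ i : Fin m, Fin (j i)
  let e : Fin J ≃o ι := Fintype.orderIsoFinOfCardEq ι (by simpa [ι] using hJ)
  let c : ι → Fin r × List (Fin n) := fun t => ((d t.1).1, (d t.1).2 ++ ρ t.1 t.2)
  have hlt : ∀ s t : ι, s < t → ∀ x y,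
      BlockLT (join (c s) (g.map (p s.1 s.2) x)) (join (c t) (g.map (p t.1 t.2) y)) := by
    rintro ⟨i, a⟩ ⟨i', b⟩ hst x y
    simp only [c, join_append]
    rcases Sigma.lex_iff.mp hst with h | ⟨h, h'⟩
    · exact hd.2 (i, _) (i', _) (Or.inl h)
    · simp only at h
      subst h
      refine hd.2 (i, _) (i, _) (Or.inr ⟨rfl, ?_⟩)
      exact (hρ i).2 a b h' _ ⟨_, ⟨x, rfl⟩, rfl⟩ _ ⟨_, ⟨y, rfl⟩, rfl⟩
  refine ⟨c ∘ e, fun l => p (e l).1 (e l).2, ⟨?_, ?_⟩, fun a b hab =>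
    hlt _ _ (e.strictMono hab)⟩
  · apply injective_of_blockLT
    rintro ⟨a, x⟩ ⟨b, y⟩ (h | ⟨h, h'⟩)
    · exact (hlt _ _ (e.strictMono h) x y).ne
    · simp only at h
      subst h
      exact fun heq => h'.ne (hinj _ (join_injective _ heq))
  · intro z
    obtain ⟨⟨i, y⟩, rfl⟩ := hd.1 z
    obtain ⟨l, _, ⟨x, rfl⟩, rfl⟩ := Set.mem_iUnion.mp ((hρ i).1.1.ge (Set.mem_univ y))
    obtain ⟨t, ht⟩ := e.surjective (⟨i, l⟩ : Σ i : Fin m, Fin (j i))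
    refine ⟨(t, x), ?_⟩
    change join (c (e t)) (g.map (p (e t).1 (e t).2) x) = _
    rw [ht]
    exact join_append _ _ _ _

/-- A homeomorphism with core `g` that preserves the circle, assembled from lexicographic viable
combinations. -/
theorem HasLexCombinations.inTOnr (hn : 2 ≤ n) [NeZero r] [NeZero s] {g : Transducer.{u} n}
    {T : Transducer.{v} n} {f₀ : CantorR n s ≃ₜ CantorR n s} (hg : IsCoreOf g f₀)
    (hT : IsCoreOf T f₀.symm) (hlex : g.PreservesLex ∨ g.ReversesLex) {m J : ℕ} (hm : 1 ≤ m)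
    (h : HasLexCombinations g m J) (hrJ : r ≡ J [MOD (n - 1)]) (hJm : J ≡ m [MOD (n - 1)]) :
    g.InTOnr r := by
  have : NeZero n := ⟨by omega⟩
  -- repeating the combinations `1 + (n - 1) r` times makes their number at least `r`
  have hN : 1 + (n - 1) * r ≡ 1 [MOD (n - 1)] := by simp [Nat.ModEq]
  have hNr : r ≤ 1 + (n - 1) * r := by
    have : 1 * r ≤ (n - 1) * r := Nat.mul_le_mul_right r (by omega)
    omega
  have hrJ' : r ≡ (1 + (n - 1) * r) * J [MOD (n - 1)] := by
    have h1 := hN.mul_right J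
    rw [one_mul] at h1
    exact hrJ.trans h1.symm
  have hrm' : r ≡ (1 + (n - 1) * r) * m [MOD (n - 1)] :=
    hrJ'.trans (hJm.mul_left _)
  replace h := h.mul (1 + (n - 1) * r)
  have hrm : r ≤ (1 + (n - 1) * r) * m := hNr.trans (Nat.le_mul_of_pos_right _ hm)
  obtain ⟨d, hd⟩ := exists_isOrderedPartition hn NeZero.one_le hrm hrm'
  obtain ⟨d', hd'⟩ := exists_isOrderedPartition hn NeZero.one_le (hrm.trans h.le) hrJ'
  have hinj : ∀ q, Function.Injective (g.map q) := fun q =>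
    hg.map_injective f₀.injective q
  obtain ⟨c, p, hbij, hsort⟩ := exists_sorted_parts h hinj hd
  rcases hlex with hlex | hlex
  · obtain ⟨f, hf, hf', hfd⟩ := exists_homeo_of_assemble hg hT d' c p hd'.bijective hbij
    have hmono : ∀ x y, BlockLT x y → BlockLT (f x) (f y) := by
      intro x y hxy
      obtain ⟨⟨a, x⟩, rfl⟩ := hd'.1 x
      obtain ⟨⟨b, y⟩, rfl⟩ := hd'.1 y
      have hab : BlockLT (a, x) (b, y) := by
        rcases blockLT_trichotomy (a, x) (b, y) with h1 | h1 | h1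
        · exact h1
        · rw [h1] at hxy
          exact (hxy.ne rfl).elim
        · exact (hxy.asymm (hd'.2 _ _ h1)).elim
      change BlockLT (f (join (d' a) x)) (f (join (d' b) y))
      rw [hfd, hfd]
      rcases hab with h1 | ⟨h1, h2⟩
      · exact hsort a b h1 x y
      · simp only at h1
        subst h1
        exact Or.inr ⟨rfl, lexLT_prepend.mpr (hlex _ _ _ h2)⟩
    obtain ⟨A, hA, hAB, he⟩ := exists_inB hn f hf hf'
    refine ⟨A, ⟨hAB, fun x y hxy => ?_⟩, he⟩
    rw [hA]
    exact circleEquiv_map_of_mono f.surjective (Or.inl hmono) hxy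
  · have hrev : Function.Bijective (assemble (c ∘ Fin.rev) fun l => g.map ((p ∘ Fin.rev) l)) :=
      hbij.comp (Equiv.prodCongr Fin.revPerm (Equiv.refl _)).bijective
    obtain ⟨f, hf, hf', hfd⟩ := exists_homeo_of_assemble hg hT d' _ _ hd'.bijective hrev
    have hanti : ∀ x y, BlockLT x y → BlockLT (f y) (f x) := by
      intro x y hxy
      obtain ⟨⟨a, x⟩, rfl⟩ := hd'.1 x
      obtain ⟨⟨b, y⟩, rfl⟩ := hd'.1 y
      have hab : BlockLT (a, x) (b, y) := by
        rcases blockLT_trichotomy (a, x) (b, y) with h1 | h1 | h1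
        · exact h1
        · rw [h1] at hxy
          exact (hxy.ne rfl).elim
        · exact (hxy.asymm (hd'.2 _ _ h1)).elim
      change BlockLT (f (join (d' b) y)) (f (join (d' a) x))
      rw [hfd, hfd]
      rcases hab with h1 | ⟨h1, h2⟩
      · exact hsort _ _ (Fin.rev_lt_rev.mpr h1) y x
      · simp only at h1
        subst h1
        exact Or.inr ⟨rfl, lexLT_prepend.mpr (hlex _ _ _ h2)⟩
    obtain ⟨A, hA, hAB, he⟩ := exists_inB hn f hf hf'
    refine ⟨A, ⟨hAB, fun x y hxy => ?_⟩, he⟩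
    rw [hA]
    exact circleEquiv_map_of_mono f.surjective (Or.inr hanti) hxy

end Combinations

/-! ### Maps that preserve twins are monotone -/

section Values

open Real

variable {n : ℕ}

/-- The difference of the values of two expansions whose first `k` digits agree. -/
theorem ofDigits_sub {x y : Cantor n} {k : ℕ} (h : ∀ i < k, x i = y i) :
    ofDigits y - ofDigits x = ((n : ℝ) ^ (k + 1))⁻¹ * (((y k : ℕ) : ℝ) - ((x k : ℕ) : ℝ) +
      (ofDigits (fun i => y (i + (k + 1))) - ofDigits fun i => x (i + (k + 1)))) := by
  rw [ofDigits_eq_sum_add_ofDigits x (k + 1), ofDigits_eq_sum_add_ofDigits y (k + 1),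
    Finset.sum_range_succ, Finset.sum_range_succ]
  have : ∑ i ∈ Finset.range k, ofDigitsTerm x i = ∑ i ∈ Finset.range k, ofDigitsTerm y i :=
    Finset.sum_congr rfl fun i hi => by simp [ofDigitsTerm, h i (Finset.mem_range.mp hi)]
  rw [this, ofDigitsTerm, ofDigitsTerm]
  ring

theorem ofDigits_le_of_lexLT {x y : Cantor n} (h : LexLT x y) : ofDigits x ≤ ofDigits y := by
  obtain ⟨k, hk, hk'⟩ := lexLT_iff.mp h
  have h1 := ofDigits_sub hk
  have h2 : ((x k : ℕ) : ℝ) + 1 ≤ ((y k : ℕ) : ℝ) := by exact_mod_cast hk'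
  have h3 := ofDigits_nonneg fun i => y (i + (k + 1))
  have h4 := ofDigits_le_one fun i => x (i + (k + 1))
  have : 0 ≤ ofDigits y - ofDigits x := by
    rw [h1]
    exact mul_nonneg (by positivity) (by linarith)
  linarith

theorem ofDigits_update_lt {x : Cantor n} {j : ℕ} {i : Fin n} (h : i < x j) :
    ofDigits (Function.update x j i) < ofDigits x := by
  have h1 := ofDigits_sub (x := Function.update x j i) (y := x) (k := j)
    fun l hl => by simp [hl.ne]
  have htail : (fun l => Function.update x j i (l + (j + 1))) = fun l => x (l + (j + 1)) := by
    funext l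
    rw [Function.update_of_ne (by omega)]
  rw [htail, sub_self, add_zero, Function.update_self] at h1
  have h2 : ((i : ℕ) : ℝ) < ((x j : ℕ) : ℝ) := by exact_mod_cast h
  have hn : (0 : ℝ) < n := by exact_mod_cast i.pos
  have : 0 < ofDigits x - ofDigits (Function.update x j i) := by
    rw [h1]
    exact mul_pos (by positivity) (by linarith)
  linarith

theorem ofDigits_lt_update {x : Cantor n} {j : ℕ} {i : Fin n} (h : x j < i) :
    ofDigits x < ofDigits (Function.update x j i) := by
  have := ofDigits_update_lt (x := Function.update x j i) (j := j) (i := x j) (by simpa using h)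
  simpa using this

theorem eq_zero_of_ofDigits_eq_zero {x : Cantor n} (h : ofDigits x = 0) (j : ℕ) :
    (x j : ℕ) = 0 := by
  by_contra hj
  have h1 := ofDigits_update_lt (x := x) (j := j) (i := ⟨0, (x j).pos⟩)
    (by simp [Fin.lt_def]; omega)
  have h2 := ofDigits_nonneg (Function.update x j ⟨0, (x j).pos⟩)
  linarith

theorem eq_last_of_ofDigits_eq_one {x : Cantor n} (h : ofDigits x = 1) (j : ℕ) :
    (x j : ℕ) + 1 = n := by
  by_contra hj
  have hpos := (x j).pos
  have h1 := ofDigits_lt_update (x := x) (j := j) (i := ⟨n - 1, by omega⟩)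
    (by simp [Fin.lt_def]; omega)
  have h2 := ofDigits_le_one (Function.update x j ⟨n - 1, by omega⟩)
  linarith

theorem ofDigits_eq_of_twin (hn : 2 ≤ n) {x y : Cantor n} (h : Twin x y) :
    ofDigits x = ofDigits y := by
  obtain ⟨k, h1, h2, h3⟩ := h
  have h4 := ofDigits_sub h1
  have h5 : ofDigits (fun i => x (i + (k + 1))) = 0 := by
    have h0 : ∀ i, (x (i + (k + 1)) : ℕ) = 0 := fun i => (h3 _ (by omega)).1
    simp [ofDigits, ofDigitsTerm, h0]
  have h6 : ofDigits (fun i => y (i + (k + 1))) = 1 := by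
    rw [← ofDigits_const_last_eq_one' (b := n) (by omega)]
    congr 1
    funext i
    have := (h3 (i + (k + 1)) (by omega)).2
    exact Fin.ext (by simp only; omega)
  rw [h5, h6, h2] at h4
  push_cast at h4
  have : ofDigits y - ofDigits x = 0 := by rw [h4]; ring
  linarith

/-- Two expansions of the same number are twins, and the number is rational. -/
theorem twin_of_ofDigits_eq {x y : Cantor n} (h : LexLT x y) (he : ofDigits x = ofDigits y) :
    Twin y x ∧ ¬ Irrational (ofDigits y) := by
  obtain ⟨k, hk, hk'⟩ := lexLT_iff.mp h
  have h1 := ofDigits_sub hk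
  have hn : (0 : ℝ) < n := by exact_mod_cast (x 0).pos
  have h2 : ((x k : ℕ) : ℝ) + 1 ≤ ((y k : ℕ) : ℝ) := by exact_mod_cast hk'
  have h3 := ofDigits_nonneg fun i => y (i + (k + 1))
  have h4 := ofDigits_le_one fun i => x (i + (k + 1))
  rw [he, sub_self, eq_comm, mul_eq_zero] at h1
  have h5 := h1.resolve_left (by positivity)
  have hy : ofDigits (fun i => y (i + (k + 1))) = 0 := by linarith
  have hx : ofDigits (fun i => x (i + (k + 1))) = 1 := by linarith
  have hxy : ((y k : ℕ) : ℝ) = ((x k : ℕ) : ℝ) + 1 := by linarith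
  refine ⟨⟨k, fun j hj => (hk j hj).symm, by exact_mod_cast hxy, fun j hj => ?_⟩, ?_⟩
  · obtain ⟨l, rfl⟩ : ∃ l, j = l + (k + 1) := ⟨j - (k + 1), by omega⟩
    exact ⟨eq_zero_of_ofDigits_eq_zero hy l, eq_last_of_ofDigits_eq_one hx l⟩
  · rw [ofDigits_eq_sum_add_ofDigits y (k + 1), hy, mul_zero, add_zero]
    refine fun hirr => hirr
      ⟨∑ i ∈ Finset.range (k + 1), ((y i : ℕ) : ℚ) * ((n : ℚ) ^ (i + 1))⁻¹, ?_⟩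
    simp [ofDigitsTerm]

theorem twin_or_twin_of_ofDigits_eq {x y : Cantor n} (h : x ≠ y)
    (he : ofDigits x = ofDigits y) : (Twin x y ∨ Twin y x) ∧ ¬ Irrational (ofDigits y) := by
  rcases lexLT_trichotomy x y with h1 | h1 | h1
  · obtain ⟨h2, h3⟩ := twin_of_ofDigits_eq h1 he
    exact ⟨Or.inr h2, h3⟩
  · exact (h h1).elim
  · obtain ⟨h2, h3⟩ := twin_of_ofDigits_eq h1 he.symm
    exact ⟨Or.inl h2, he ▸ h3⟩

/-- A continuous injection which is weakly monotone for the numerical values is monotone for the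
lexicographic order: if `φ` exchanged the order of a pair `x < y`, the values of `φ x` and `φ y`
would agree, and the value of `φ x'` for a point `x'` close to `x` would be the same. -/
theorem lexMono_of_ofDigits_le (hn : 2 ≤ n) {φ : Cantor n → Cantor n} (hc : Continuous φ)
    (hi : Function.Injective φ) (h : ∀ x y, LexLT x y → ofDigits (φ x) ≤ ofDigits (φ y)) :
    LexMono φ := by
  intro x y hxy
  rcases lexLT_trichotomy (φ x) (φ y) with h1 | h1 | h1
  · exact h1
  · exact (hxy.ne (hi h1)).elim
  exfalso
  have he : ofDigits (φ y) = ofDigits (φ x) := le_antisymm (ofDigits_le_of_lexLT h1) (h x y hxy)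
  have ht := (twin_of_ofDigits_eq h1 he).1
  obtain ⟨k, -, -, hk⟩ := id ht
  obtain ⟨m, hm⟩ := exists_initialWord_of_continuous hc x (k + 1)
  obtain ⟨l, hl, hl'⟩ := lexLT_iff.mp hxy
  obtain ⟨a, ha⟩ := exists_ne_letter hn (x (max m (l + 1)))
  set x' := Function.update x (max m (l + 1)) a with hx'
  have hagree : ∀ i < max m (l + 1), x' i = x i := fun i hi => by simp [hx', hi.ne]
  have hx'y : LexLT x' y := by
    refine ⟨l, fun j hj => ?_, ?_⟩
    · exact (hagree j (by omega)).trans (hl j hj)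
    · change x' l < y l
      rw [hagree l (by omega)]
      exact hl'
  have hne : φ x' ≠ φ x := fun heq => ha (by
    have := congrFun (hi heq) (max m (l + 1))
    simpa [hx'] using this)
  have hφ := initialWord_eq_iff.mp (hm x' (initialWord_eq_iff.mpr fun i hi => hagree i (by omega)))
  have hlt : LexLT (φ x) (φ x') := by
    rcases lexLT_trichotomy (φ x) (φ x') with h2 | h2 | h2
    · exact h2
    · exact (hne h2.symm).elim
    · obtain ⟨j, -, hj⟩ := lexLT_iff.mp h2
      rcases lt_or_ge k j with hkj | hkj
      · have := (hk j hkj).1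
        omega
      · rw [hφ j (by omega)] at hj
        exact (lt_irrefl _ hj).elim
  have h3 : ofDigits (φ y) = ofDigits (φ x') :=
    le_antisymm (he.le.trans (ofDigits_le_of_lexLT hlt)) (h x' y hx'y)
  have ht' := (twin_of_ofDigits_eq (h1.trans hlt) h3).1
  exact ((twin_iff _ _).mp ht').2 _ ⟨h1, hlt⟩

/-- A continuous injection that preserves twins induces a continuous map of `[0, 1]`. If this map
were not monotone, it would take some irrational value twice, whereas an irrational number has only
one expansion. -/
theorem lexMono_or_lexAnti (hn : 2 ≤ n) {φ : Cantor n → Cantor n} (hc : Continuous φ)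
    (hi : Function.Injective φ)
    (htwin : ∀ x y, Twin x y → Twin (φ x) (φ y) ∨ Twin (φ y) (φ x)) :
    LexMono φ ∨ LexAnti φ := by
  have hfac : ∀ x y, ofDigits x = ofDigits y → ofDigits (φ x) = ofDigits (φ y) := by
    intro x y hxy
    rcases eq_or_ne x y with rfl | hne
    · rfl
    rcases (twin_or_twin_of_ofDigits_eq hne hxy).1 with h | h <;>
    rcases htwin _ _ h with h' | h' <;>
    first
    | exact ofDigits_eq_of_twin hn h'
    | exact (ofDigits_eq_of_twin hn h').symm
  let val : Cantor n → Set.Icc (0 : ℝ) 1 := fun x =>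
    ⟨ofDigits x, ofDigits_nonneg x, ofDigits_le_one x⟩
  have hval : Continuous val := continuous_ofDigits.subtype_mk _
  have hsurj : Function.Surjective val := fun t => by
    obtain ⟨x, -, hx⟩ := ofDigits_SurjOn (b := n) (by omega) t.2
    exact ⟨x, Subtype.ext hx⟩
  have hquot : Topology.IsQuotientMap val := hval.isClosedMap.isQuotientMap hval hsurj
  choose e he using hsurj
  let Ψ : Set.Icc (0 : ℝ) 1 → ℝ := fun t => ofDigits (φ (e t))
  have hΨval : ∀ x, Ψ (val x) = ofDigits (φ x) := fun x =>
    hfac _ _ (congrArg Subtype.val (he (val x)))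
  have hΨ : Continuous Ψ := by
    rw [hquot.continuous_iff]
    have : Ψ ∘ val = fun x => ofDigits (φ x) := funext hΨval
    rw [this]
    exact continuous_ofDigits.comp hc
  let F : ℝ → ℝ := Set.IccExtend zero_le_one Ψ
  have hF : Continuous F := hΨ.Icc_extend'
  have hFval : ∀ x, F (ofDigits x) = ofDigits (φ x) := fun x => by
    rw [← hΨval]
    exact Set.IccExtend_of_mem _ _ (val x).2
  have huniq : ∀ s ∈ Set.Icc (0 : ℝ) 1, ∀ t ∈ Set.Icc (0 : ℝ) 1, Irrational (F t) → F s = F t →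
      s = t := by
    intro s hs t ht hirr hst
    obtain ⟨x, -, rfl⟩ := ofDigits_SurjOn (b := n) (by omega) hs
    obtain ⟨y, -, rfl⟩ := ofDigits_SurjOn (b := n) (by omega) ht
    rw [hFval, hFval] at hst
    rw [hFval] at hirr
    by_contra hne
    have hφ : φ x ≠ φ y := fun h => hne (by rw [hi h])
    exact (twin_or_twin_of_ofDigits_eq hφ hst).2 hirr
  have hmono : Monotone Ψ ∨ Antitone Ψ := by
    by_contra hcon
    have hΨF : ∀ t, Ψ t = F t := fun t => (Set.IccExtend_val _ _ t).symm
    rw [not_or, not_monotone_not_antitone_iff_exists_le_le] at hcon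
    simp only [hΨF] at hcon
    obtain ⟨⟨a, ha⟩, ⟨b, hb⟩, ⟨c, hc'⟩, hab, hbc, h⟩ := hcon
    replace hab : a ≤ b := hab
    replace hbc : b ≤ c := hbc
    rcases h with h | h
    · obtain ⟨t, hirr, ht1, ht2⟩ := exists_irrational_btwn (max_lt h.1 h.2)
      obtain ⟨s, hs, rfl⟩ := intermediate_value_Icc hab hF.continuousOn
        ⟨(le_max_left _ _).trans ht1.le, ht2.le⟩
      obtain ⟨s', hs', hss'⟩ := intermediate_value_Icc' hbc hF.continuousOn
        ⟨(le_max_right _ _).trans ht1.le, ht2.le⟩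
      have := huniq s' ⟨hb.1.trans hs'.1, hs'.2.trans hc'.2⟩ s
        ⟨ha.1.trans hs.1, hs.2.trans hb.2⟩ hirr hss'
      subst this
      rw [le_antisymm hs.2 hs'.1] at ht2
      exact lt_irrefl _ ht2
    · obtain ⟨t, hirr, ht1, ht2⟩ := exists_irrational_btwn (lt_min h.1 h.2)
      obtain ⟨s, hs, rfl⟩ := intermediate_value_Icc' hab hF.continuousOn
        ⟨ht1.le, ht2.le.trans (min_le_left _ _)⟩
      obtain ⟨s', hs', hss'⟩ := intermediate_value_Icc hbc hF.continuousOn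
        ⟨ht1.le, ht2.le.trans (min_le_right _ _)⟩
      have := huniq s' ⟨hb.1.trans hs'.1, hs'.2.trans hc'.2⟩ s
        ⟨ha.1.trans hs.1, hs.2.trans hb.2⟩ hirr hss'
      subst this
      rw [le_antisymm hs.2 hs'.1] at ht1
      exact lt_irrefl _ ht1
  rcases hmono with hmono | hmono
  · refine Or.inl (lexMono_of_ofDigits_le hn hc hi fun x y hxy => ?_)
    rw [← hΨval, ← hΨval]
    exact hmono (ofDigits_le_of_lexLT hxy : val x ≤ val y)
  · -- composition with the order-reversing involution of the Cantor space
    let rev : Cantor n → Cantor n := fun x i => Fin.rev (x i)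
    have hrev : Continuous rev :=
      continuous_pi fun i => (continuous_of_discreteTopology (f := Fin.rev)).comp
        (continuous_apply i)
    have hinv : ∀ x, rev (rev x) = x := fun x => funext fun i => Fin.rev_rev _
    have hlt : ∀ x y, LexLT x y → LexLT (rev y) (rev x) := by
      rintro x y ⟨k, hk, hk'⟩
      exact ⟨k, fun j hj => congrArg Fin.rev (hk j hj).symm, Fin.rev_lt_rev.mpr hk'⟩
    have h1 : LexMono (φ ∘ rev) := by
      refine lexMono_of_ofDigits_le hn (hc.comp hrev)
        (hi.comp (Function.LeftInverse.injective hinv)) fun x y hxy => ?_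
      rw [Function.comp, Function.comp, ← hΨval, ← hΨval]
      exact hmono (ofDigits_le_of_lexLT (hlt _ _ hxy) : val (rev y) ≤ val (rev x))
    refine Or.inr fun x y hxy => ?_
    have := h1 _ _ (hlt x y hxy)
    simpa only [Function.comp, hinv] using this

end Values

/-! ### The core of a homeomorphism that preserves the circle -/

section CirclePreserving

variable {n r : ℕ}

theorem twin_prepend {w : List (Fin n)} {x y : Cantor n} :
    Twin (prepend w x) (prepend w y) ↔ Twin x y := by
  simp only [twin_iff, lexLT_prepend]
  refine and_congr_right fun _ => ⟨fun h z hz => h (prepend w z) ?_, fun h z hz => ?_⟩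
  · simpa only [lexLT_prepend] using hz
  · obtain ⟨t, rfl⟩ := isPrefixOf_of_lexLT hz.1 hz.2
    simp only [lexLT_prepend] at hz
    exact h t hz

/-- Equivalent points with a common prefix that contains an undotted letter are twins. -/
theorem twin_of_circleEquiv_join (hn : 2 ≤ n) {c : Fin r × List (Fin n)} (hc : c.2 ≠ [])
    {x y : Cantor n} (hne : x ≠ y) (h : CircleEquiv (join c x) (join c y)) :
    Twin x y ∨ Twin y x := by
  have key : ∀ x y, TwinR (join c x) (join c y) → Twin x y := by
    rintro x y (⟨-, h⟩ | ⟨-, h⟩)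
    · exact twin_prepend.mp h
    · have h0 := h 0
      have hlen : 0 < c.2.length := List.length_pos_iff.mpr hc
      simp only [join, prepend_of_lt _ _ hlen] at h0
      omega
  rcases h with h | h | h
  · exact (hne (join_injective c h)).elim
  · exact Or.inl (key _ _ h)
  · exact Or.inr (key _ _ h)

/-- The core of a homeomorphism that preserves the circle consists of monotone maps. -/
theorem IsCoreOf.preservesLex_or_reversesLex (hn : 2 ≤ n) [NeZero r] {g : Transducer.{u} n}
    {f : CantorR n r → CantorR n r} (hg : IsCoreOf g f) (hf : Function.Injective f)
    (h : ∀ x y, CircleEquiv x y → CircleEquiv (f x) (f y)) :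
    g.PreservesLex ∨ g.ReversesLex := by
  have : NeZero n := ⟨by omega⟩
  obtain ⟨D, k, τ, hsurj, hst, -⟩ := hg.exists_sync
  have hk : (List.replicate k (0 : Fin n)).length = k := by simp
  obtain ⟨d, c, hc⟩ := hg.exists_eq_join (τ (List.replicate k 0))
  -- some undotted letter is written first: for `r = 1`, the least and the greatest point of the
  -- only copy of the Cantor space are equivalent without being neighbours
  obtain ⟨l, hl⟩ := g.productive (τ (List.replicate k 0)) 0 0
  set w := initialWord (0 : Cantor n) l
  set q := g.st w (τ (List.replicate k 0)) with hq
  have hw : ∀ x, f (join (d.1, d.2 ++ w) x)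
      = join (c.1, c.2 ++ g.wr w (τ (List.replicate k 0))) (g.map q x) := fun x => by
    rw [join_append, join_append, ← g.map_prepend]
    exact hc _
  have hne : c.2 ++ g.wr w (τ (List.replicate k 0)) ≠ [] := by
    intro h0
    have h1 : g.wr w (τ (List.replicate k 0)) = [] := (List.append_eq_nil_iff.mp h0).2
    have h2 : 0 < (g.wr w (τ (List.replicate k 0))).length := hl
    rw [h1] at h2
    exact lt_irrefl _ h2
  have hi := hg.map_injective hf
  have hq' : LexMono (g.map q) ∨ LexAnti (g.map q) := by
    refine lexMono_or_lexAnti hn (g.continuous_map q) (hi q) fun x y hxy => ?_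
    have hxy' : x ≠ y := by
      rintro rfl
      exact ((twin_iff _ _).mp hxy).1.ne rfl
    refine twin_of_circleEquiv_join hn (c := (c.1, _)) hne ((hi q).ne hxy') ?_
    rw [← hw, ← hw]
    exact h _ _ (Or.inr (Or.inl (Or.inl ⟨rfl, twin_prepend.mpr hxy⟩)))
  have hreach : ∀ q', ∃ v, ∀ x, g.map q (prepend v x) = prepend (g.wr v q) (g.map q' x) := by
    intro q'
    obtain ⟨v, hv, rfl⟩ := hsurj q'
    refine ⟨v, fun x => ?_⟩
    rw [g.map_prepend, hst q v hv]
  rcases hq' with hq' | hq'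
  · refine Or.inl fun q' x y hxy => ?_
    obtain ⟨v, hv⟩ := hreach q'
    have := hq' _ _ (lexLT_prepend (w := v).mpr hxy)
    rwa [hv, hv, lexLT_prepend] at this
  · refine Or.inr fun q' x y hxy => ?_
    obtain ⟨v, hv⟩ := hreach q'
    have := hq' _ _ (lexLT_prepend (w := v).mpr hxy)
    rwa [hv, hv, lexLT_prepend] at this

end CirclePreserving

end HigmanThompson

theorem mainTheorem3 (n r : ℕ) (hn : 2 ≤ n) (hr : 1 ≤ r) (hrn : r ≤ n - 1)
    (g : HigmanThompson.Transducer.{u} n) (hg : g.InOn) :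
    List.TFAE
      [ g.InTOnr r,
        (g.PreservesLex ∨ g.ReversesLex) ∧
          ∃ (m : ℕ) (j : Fin m → ℕ), 1 ≤ m ∧
            (∀ i, ∃ (ρ : Fin (j i) → List (Fin n)) (p : Fin (j i) → g.State),
              g.IsLexViable ρ p) ∧
            r ≡ ∑ i, j i [MOD (n - 1)] ∧ ∑ i, j i ≡ m [MOD (n - 1)],
        (g.PreservesLex ∨ g.ReversesLex) ∧
          ∃ (m : ℕ) (j : Fin m → ℕ), 1 ≤ m ∧
            (∀ i, ∃ (ρ : Fin (j i) → List (Fin n)) (p : Fin (j i) → g.State),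
              g.IsViable ρ p) ∧
            r ≡ ∑ i, j i [MOD (n - 1)] ∧ ∑ i, j i ≡ m [MOD (n - 1)],
        g.InOnr r ∧ (g.PreservesLex ∨ g.ReversesLex) ] := by
  have : NeZero n := ⟨by omega⟩
  have : NeZero r := ⟨by omega⟩
  obtain ⟨s, hs, -, hgs⟩ := hg
  have : NeZero s := ⟨by omega⟩
  obtain ⟨f₀, T, hg₀, hT₀⟩ := hgs.exists_homeo
  tfae_have 1 → 4 := by
    rintro ⟨A, ⟨hA, hcirc⟩, ⟨e⟩⟩
    exact ⟨⟨A, hA, ⟨e⟩⟩, (hA.2.1.isCoreOf.of_iso e).preservesLex_or_reversesLex hn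
      hA.1.injective hcirc⟩
  tfae_have 4 → 3 := by
    rintro ⟨hgr, hlex⟩
    obtain ⟨f, -, hf, -⟩ := hgr.exists_homeo
    obtain ⟨L, j, hj, hsum⟩ := hf.exists_isViable
    have hpow : n ^ L ≡ 1 [MOD (n - 1)] := by
      have h1 : n ≡ 1 [MOD (n - 1)] := ((Nat.modEq_iff_dvd' (by omega)).mpr dvd_rfl).symm
      simpa using h1.pow L
    have hmod : r * n ^ L ≡ r [MOD (n - 1)] := by simpa using hpow.mul_left r
    exact ⟨hlex, r, j, hr, hj, hsum ▸ hmod.symm, hsum ▸ hmod⟩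
  tfae_have 3 → 2 := by
    rintro ⟨hlex, m, j, hm, hj, h1, h2⟩
    refine ⟨hlex, m, j, hm, fun i => ?_, h1, h2⟩
    obtain ⟨ρ, p, h⟩ := hj i
    exact h.exists_isLexViable fun q x y z => hg₀.convex_range
      (fun q => hlex.imp (fun h => h q) fun h => h q) q
  tfae_have 2 → 1 := by
    rintro ⟨hlex, m, j, hm, hj, h1, h2⟩
    exact HigmanThompson.HasLexCombinations.inTOnr hn hg₀ hT₀ hlex hm ⟨j, hj, rfl⟩ h1 h2
  tfae_finish
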